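/- Let $\mathbf k$ be a commutative unital $\mathbb Q$-algebra and $q\in\mathbf k$. Let $Y=\{y_s\}_{s\ge1}$ be the alphabet totally ordered by $y_1>y_2>\cdots$, let $Y^*$ be the set of words over $Y$ (ordered lexicographically), $Y^+$ the set of nonempty words, and $\mathrm{Lyn}\,Y$ the set of Lyndon words (nonempty words strictly smaller than each of their proper nonempty right factors). On the module $\mathbf k\langle Y\rangle$ of noncommutative polynomials, define the bilinear $q$-stuffle product $\star_q$ by $u\,\star_q \,1=1\,\star_q \,u=u$ and $$y_su\,\star_q \,y_tv=y_s(u\,\star_q \,y_tv)+y_t(y_su\,\star_q \,v)+q\,y_{s+t}(u\,\star_q \,v),$$ and let $\Delta$ be the algebra morphism $\mathbf k\langle Y\rangle\to\mathbf k\langle Y\rangle\otimes\mathbf k\langle Y\rangle$ (for concatenation) with $\Delta(y_s)=y_s\otimes1+1\otimes y_s+q\sum_{s_1+s_2=s}y_{s_1}\otimes y_{s_2}$, where $s_1,s_2\ge1$. Let $\mathcal P=\{P\in\mathbf k\langle Y\rangle:\Delta P=P\otimes1+1\otimes P\}$, and let $\langle\cdot|\cdot\rangle$ be the bilinear form on $\mathbf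 k\langle Y\rangle$ for which the words are orthonormal. For $w\in Y^+$ put $$\pi_1(w)=w+\sum_{k\ge2}\frac{(-1)^{k-1}}{k}\sum_{u_1,\dots,u_k\in Y^+}\langle w\,|\,u_1\star_q \cdots\star_q u_k\rangle\,u_1\cdots u_k .$$ Define $\Pi_{y_s}=\pi_1(y_s)$; $\Pi_l=[\Pi_{l'},\Pi_{l''}]=\Pi_{l'}\Pi_{l''}-\Pi_{l''}\Pi_{l'}$ for a Lyndon word $l$ of length at least $2$ with standard factorization $l=l'l''$ ($l''$ the longest proper right factor of $l$ that is a Lyndon word); and $\Pi_w=\Pi_{l_1}\cdots\Pi_{l_n}$ for $w=l_1\cdots l_n$ with Lyndon words $l_1\ge\cdots\ge l_n$. Then: 1. $\{\Pi_l\}_{l\in\mathrm{Lyn}\,Y}$ is a basis of the $\mathbf k$-module $\mathcal P$. 2. $\{\Pi_w\}_{w\in Y^*}$ is a basis of the $\mathbf k$-module $\mathbf k\langle Y\rangle$. Moreover there is a unique family $\{\Sigma_w\}_{w\in Y^*}$ in $\mathbf k\langle Y\rangle$ with $\langle\Sigma_v|\Pi_u\rangle=\delta_{u,v}$ for all $u,v\in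 Y^*$, and: 3. $\{\Sigma_w\}_{w\in Y^*}$ freely generates the $q$-stuffle algebra $(\mathbf k\langle Y\rangle,\star_q )$ as a $\mathbf k$-module, that is, it is a linear basis. 4. $\{\Sigma_l\}_{l\in\mathrm{Lyn}\,Y}$ is a transcendence basis of the commutative $\mathbf k$-algebra $(\mathbf k\langle Y\rangle,\star_q )$: it is a maximal algebraically independent family, and it generates the algebra (so the algebra is the polynomial algebra in the $\Sigma_l$). -/

import Mathlib

namespace QStuffle

theorem exists_suffix_prefix {α : Type*} (ls : List (List α)) :
    ∀ x : List α, x ≠ [] → x <+: ls.flatten →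
    ∃ s, s ≠ [] ∧ s <:+ x ∧ ∃ m ∈ ls, s <+: m := by
  induction ls with
  | nil => intro x hx h; simp at h; exact absurd h hx
  | cons m ls ih =>
    intro x hx h
    rw [List.flatten_cons] at h
    obtain ⟨t, ht⟩ := h
    rcases List.append_eq_append_iff.1 ht with ⟨c, hc1, hc2⟩ | ⟨c, hc1, hc2⟩
    · exact ⟨x, hx, List.suffix_refl x, m, by simp, ⟨c, hc1.symm⟩⟩
    · by_cases hc : c = []
      · subst hc
        exact ⟨x, hx, List.suffix_refl x, m, by simp, by simp [hc1]⟩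
      · obtain ⟨s, hs, hsx, m', hm', hsm⟩ := ih c hc ⟨t, hc2.symm⟩
        exact ⟨s, hs, hsx.trans ⟨m, hc1.symm⟩, m', by simp [hm'], hsm⟩

noncomputable section Lyndon
variable {α : Type*} [LinearOrder α]

/-- Lyndon word for the lexicographic order: nonempty, and strictly smaller than each of its
proper nonempty right factors. -/
def IsLyndon (w : List α) : Prop :=
  w ≠ [] ∧ ∀ u v : List α, u ≠ [] → v ≠ [] → w = u ++ v → w < v

theorem isLyndon_singleton (a : α) : IsLyndon [a] := by
  refine ⟨by simp, fun u v hu hv h => ?_⟩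
  have := congrArg List.length h
  have h1 := List.length_pos_iff.2 hu
  have h2 := List.length_pos_iff.2 hv
  simp at this
  omega

theorem append_lt_append_of_lt {u v : List α} (h : u < v) (hp : ¬ u <+: v) (s t : List α) :
    u ++ s < v ++ t := by
  induction u generalizing v with
  | nil => exact absurd List.nil_prefix hp
  | cons a u ih =>
    cases v with
    | nil => exact absurd h (by simp)
    | cons b v =>
      rw [List.cons_lt_cons_iff] at h
      rw [List.cons_append, List.cons_append, List.cons_lt_cons_iff]
      rcases h with h | ⟨rfl, h⟩
      · exact Or.inl h
      · exact Or.inr ⟨rfl, ih h fun hq => hp (by simpa using hq)⟩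

theorem append_left_lt (u : List α) {s t : List α} (h : s < t) : u ++ s < u ++ t := by
  induction u with
  | nil => exact h
  | cons a u ih => rw [List.cons_append, List.cons_append, List.cons_lt_cons_iff]; exact Or.inr ⟨rfl, ih⟩

theorem le_of_prefix {u v : List α} (h : u <+: v) : u ≤ v := by
  obtain ⟨t, rfl⟩ := h
  induction u with
  | nil => exact not_lt.1 (by simp)
  | cons a u ih =>
    rw [List.cons_append]; exact List.cons_le_cons a ih

theorem IsLyndon.append {u v : List α} (hu : IsLyndon u) (hv : IsLyndon v) (h : u < v) :
    IsLyndon (u ++ v) := by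
  have key : u ++ v < v := by
    by_cases hp : u <+: v
    · obtain ⟨t, rfl⟩ := hp
      have ht : t ≠ [] := by rintro rfl; simp at h
      exact append_left_lt u (hv.2 u t hu.1 ht rfl)
    · simpa using append_lt_append_of_lt h hp v []
  refine ⟨by simp [hu.1], fun x y hx hy hxy => ?_⟩
  rcases List.append_eq_append_iff.1 hxy with ⟨c, hc1, hc2⟩ | ⟨c, hc1, hc2⟩
  · by_cases hc : c = []
    · subst hc; simp at hc2; rwa [← hc2]
    · exact key.trans (hv.2 c y hc hy hc2)
  · by_cases hc : c = []
    · subst hc; simp at hc2; rwa [hc2]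
    · have h1 := hu.2 x c hx hc hc1
      rw [hc2]
      refine append_lt_append_of_lt h1 (fun hp => ?_) _ _
      have h2 := hp.length_le
      have h3 := congrArg List.length hc1
      have := List.length_pos_iff.2 hx
      simp at h3
      omega

/-- `ls = (l₁, …, lₙ)` is a factorization `w = l₁ ⋯ lₙ` into Lyndon words `l₁ ≥ ⋯ ≥ lₙ`. -/
def IsLyndonFactorization (w : List α) (ls : List (List α)) : Prop :=
  (∀ l ∈ ls, IsLyndon l) ∧ ls.Pairwise (fun a b => b ≤ a) ∧ ls.flatten = w

theorem exists_factorization_append (ls : List (List α)) : ∀ (l : List α), IsLyndon l →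
    (∀ l ∈ ls, IsLyndon l) → ls.Pairwise (fun a b => b ≤ a) →
    ∃ ms, IsLyndonFactorization (l ++ ls.flatten) ms := by
  induction ls with
  | nil => intro l hl _ _; exact ⟨[l], by simp [IsLyndonFactorization, hl]⟩
  | cons m ls ih =>
    intro l hl h1 h2
    by_cases h : l < m
    · obtain ⟨ms, hms⟩ := ih (l ++ m) (hl.append (h1 m (by simp)) h)
        (fun x hx => h1 x (by simp [hx])) (List.pairwise_cons.1 h2).2
      exact ⟨ms, by simpa using hms⟩
    · refine ⟨l :: m :: ls, ?_, ?_, by simp⟩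
      · intro x hx
        rcases List.mem_cons.1 hx with rfl | hx
        · exact hl
        · exact h1 x hx
      · refine List.pairwise_cons.2 ⟨fun x hx => ?_, h2⟩
        rcases List.mem_cons.1 hx with rfl | hx
        · exact not_lt.1 h
        · exact ((List.pairwise_cons.1 h2).1 x hx).trans (not_lt.1 h)

theorem exists_lyndonFactorization (w : List α) : ∃ ls, IsLyndonFactorization w ls := by
  induction w with
  | nil => exact ⟨[], by simp [IsLyndonFactorization]⟩
  | cons a w ih =>
    obtain ⟨ls, h1, h2, rfl⟩ := ih
    simpa using exists_factorization_append ls [a] (isLyndon_singleton a) h1 h2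

theorem lyndon_prefix_length_le {p t l : List α} {ls : List (List α)} (hp : IsLyndon p)
    (h : (l :: ls).Pairwise (fun a b => b ≤ a)) (hl : l ≠ [])
    (hpt : p ++ t = (l :: ls).flatten) : p.length ≤ l.length := by
  rw [List.flatten_cons] at hpt
  rcases List.append_eq_append_iff.1 hpt with ⟨c, hc1, _⟩ | ⟨c, hc1, hc2⟩
  · simp [hc1]
  · by_cases hc : c = []
    · simp [hc1, hc]
    · exfalso
      obtain ⟨s, hs, hsx, m, hm, hsm⟩ := exists_suffix_prefix ls c hc ⟨t, hc2.symm⟩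
      obtain ⟨d, hd⟩ := hsx
      have h1 : p < s := hp.2 (l ++ d) s (by simp [hl]) hs (by simp [hc1, ← hd])
      have h2 : s ≤ m := le_of_prefix hsm
      have h3 : m ≤ l := (List.pairwise_cons.1 h).1 m hm
      have h4 : l ≤ p := le_of_prefix ⟨c, hc1.symm⟩
      exact absurd (((h1.trans_le h2).trans_le h3).trans_le h4) (lt_irrefl _)

theorem lyndonFactorization_unique (ls : List (List α)) : ∀ (w : List α) (ms : List (List α)),
    IsLyndonFactorization w ls → IsLyndonFactorization w ms → ls = ms := by
  induction ls with
  | nil =>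
    rintro w ms ⟨_, _, rfl⟩ ⟨h1, _, h3⟩
    cases ms with
    | nil => rfl
    | cons m ms => simp at h3; exact absurd h3.1 (h1 m (by simp)).1
  | cons l ls ih =>
    rintro w ms ⟨h1, h2, rfl⟩ ⟨g1, g2, g3⟩
    cases ms with
    | nil => simp at g3; exact absurd g3.1 (h1 l (by simp)).1
    | cons m ms =>
      have hl := h1 l (by simp)
      have hm := g1 m (by simp)
      have e1 := lyndon_prefix_length_le hm h2 hl.1 (by rw [← g3, List.flatten_cons])
      have e2 := lyndon_prefix_length_le hl g2 hm.1 (by rw [g3, List.flatten_cons])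
      rw [List.flatten_cons, List.flatten_cons] at g3
      obtain ⟨rfl, h⟩ := List.append_inj g3 (le_antisymm e1 e2)
      rw [ih _ ms ⟨fun x hx => h1 x (by simp [hx]), (List.pairwise_cons.1 h2).2, rfl⟩
        ⟨fun x hx => g1 x (by simp [hx]), (List.pairwise_cons.1 g2).2, h⟩]

/-- The non-increasing factorization of `w` into Lyndon words; it exists and is unique by
`exists_lyndonFactorization` and `lyndonFactorization_unique`. -/
def lyndonFactorization (w : List α) : List (List α) := (exists_lyndonFactorization w).choose

/-- The length of `s` in the standard factorization `(s, r)` of a Lyndon word `w` of length at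
least two, where `r` is the longest proper right factor of `w` that is a Lyndon word. -/
def stdIndex (w : List α) : ℕ := sInf {i | 0 < i ∧ IsLyndon (w.drop i)}

/-- The left part `s` of the standard factorization `(s, r)`. -/
def stdLeft (w : List α) : List α := w.take (stdIndex w)

/-- The right part `r` of the standard factorization `(s, r)`. -/
def stdRight (w : List α) : List α := w.drop (stdIndex w)

theorem stdIndex_spec (w : List α) (h : 2 ≤ w.length) :
    0 < stdIndex w ∧ stdIndex w < w.length ∧ IsLyndon (w.drop (stdIndex w)) := by
  have hne : {i | 0 < i ∧ IsLyndon (w.drop i)}.Nonempty := by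
    refine ⟨w.length - 1, by omega, ?_⟩
    obtain ⟨a, ha⟩ := List.length_eq_one_iff.1 (show (w.drop (w.length - 1)).length = 1 by
      rw [List.length_drop]; omega)
    rw [ha]
    exact isLyndon_singleton a
  obtain ⟨h1, h2⟩ : 0 < stdIndex w ∧ IsLyndon (w.drop (stdIndex w)) := Nat.sInf_mem hne
  refine ⟨h1, ?_, h2⟩
  by_contra hlt
  exact h2.1 (List.drop_eq_nil_of_le (not_lt.1 hlt))

end Lyndon

/-- The alphabet `Y = {y_s : s ≥ 1}`, with the total order `y₁ > y₂ > ⋯`. -/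
abbrev Letter : Type := ℕ+ᵒᵈ
/-- The letter `y_s`. -/
def y (s : ℕ+) : Letter := OrderDual.toDual s
/-- The index `s` of the letter `y_s`. -/
def index (a : Letter) : ℕ+ := OrderDual.ofDual a
/-- From `y_s` and `y_t`, the letter `y_{s+t}`. -/
def mergeLetters (a b : Letter) : Letter := y (index a + index b)
/-- Words over `Y`, ordered lexicographically. -/
abbrev Word : Type := List Letter
/-- The weight `(w) = i₁ + ⋯ + i_r` of `w = y_{i₁} ⋯ y_{i_r}`. -/
def weight (w : Word) : ℕ := (w.map fun a => (index a : ℕ)).sum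

theorem weight_nil : weight [] = 0 := rfl

theorem weight_cons (a : Letter) (w : Word) : weight (a :: w) = index a + weight w := by
  simp [weight]

theorem weight_append (u v : Word) : weight (u ++ v) = weight u + weight v := by
  simp [weight]

theorem weight_flatten (us : List Word) : weight us.flatten = (us.map weight).sum := by
  induction us with
  | nil => rfl
  | cons u us ih => rw [List.flatten_cons, weight_append, ih, List.map_cons, List.sum_cons]

theorem index_mergeLetters (a b : Letter) :
    (index (mergeLetters a b) : ℕ) = index a + index b := rfl

noncomputable section
variable {k : Type*} [CommRing k]

/-- Noncommutative polynomials `k⟨Y⟩`; the multiplication is concatenation. -/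
abbrev Poly (k : Type*) [CommRing k] : Type _ := MonoidAlgebra k (FreeMonoid Letter)

/-- A word seen as a polynomial. -/
def word (k : Type*) [CommRing k] (w : Word) : Poly k :=
  MonoidAlgebra.single (FreeMonoid.ofList w) 1

/-- The coefficient `⟨P | w⟩` of the word `w` in `P`. -/
def coeff (P : Poly k) (w : Word) : k := P.coeff (FreeMonoid.ofList w)

/-- The pairing `⟨P | Q⟩ = ∑_w ⟨P | w⟩ ⟨Q | w⟩`, for which words are orthonormal. -/
def pairing (P Q : Poly k) : k := P.coeff.sum fun w a => a * Q.coeff w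

/-- The `q`-stuffle of two words. -/
def stuffleWord (q : k) : Word → Word → Poly k
  | [], v => word k v
  | u, [] => word k u
  | a :: u, b :: v =>
      word k [a] * stuffleWord q u (b :: v) + word k [b] * stuffleWord q (a :: u) v
        + q • (word k [mergeLetters a b] * stuffleWord q u v)
termination_by u v => u.length + v.length

/-- The `q`-stuffle product on `k⟨Y⟩`, extended bilinearly from words. -/
def stuffle (q : k) : Poly k →ₗ[k] Poly k →ₗ[k] Poly k :=
  (MonoidAlgebra.basis (FreeMonoid Letter) k).constr k fun u =>
    (MonoidAlgebra.basis (FreeMonoid Letter) k).constr k fun v =>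
      stuffleWord q (FreeMonoid.toList u) (FreeMonoid.toList v)

theorem stuffle_word (q : k) (u v : Word) :
    stuffle q (word k u) (word k v) = stuffleWord q u v := by
  have h (w : Word) : word k w = MonoidAlgebra.basis (FreeMonoid Letter) k (FreeMonoid.ofList w) :=
    rfl
  rw [stuffle, h, h, Module.Basis.constr_basis, Module.Basis.constr_basis]
  rfl

theorem stuffle_nil_word (q : k) (v : Word) : stuffle q (word k []) (word k v) = word k v := by
  rw [stuffle_word]; unfold stuffleWord; rfl

theorem stuffle_word_nil (q : k) (v : Word) : stuffle q (word k v) (word k []) = word k v := by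
  rw [stuffle_word]; cases v <;> (unfold stuffleWord; rfl)

theorem word_append (u v : Word) : word k (u ++ v) = word k u * word k v := by
  simp [word]

theorem word_cons (a : Letter) (v : Word) : word k (a :: v) = word k [a] * word k v :=
  word_append [a] v

theorem poly_ext {M : Type*} [AddCommMonoid M] [Module k M] {f g : Poly k →ₗ[k] M}
    (h : ∀ w, f (word k w) = g (word k w)) : f = g :=
  (MonoidAlgebra.basis (FreeMonoid Letter) k).ext fun w => h (FreeMonoid.toList w)

theorem stuffle_cons_cons (q : k) (a b : Letter) (P Q : Poly k) :
    stuffle q (word k [a] * P) (word k [b] * Q) =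
      word k [a] * stuffle q P (word k [b] * Q) + word k [b] * stuffle q (word k [a] * P) Q
        + q • (word k [mergeLetters a b] * stuffle q P Q) := by
  have key : (stuffle q).compl₁₂ (LinearMap.mulLeft k (word k [a])) (LinearMap.mulLeft k (word k [b]))
      = ((stuffle q).compl₁₂ LinearMap.id (LinearMap.mulLeft k (word k [b]))).compr₂
            (LinearMap.mulLeft k (word k [a]))
        + ((stuffle q).compl₁₂ (LinearMap.mulLeft k (word k [a])) LinearMap.id).compr₂
            (LinearMap.mulLeft k (word k [b]))
        + q • (stuffle q).compr₂ (LinearMap.mulLeft k (word k [mergeLetters a b])) := by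
    refine poly_ext fun u => poly_ext fun v => ?_
    simp only [LinearMap.compl₁₂_apply, LinearMap.mulLeft_apply, LinearMap.add_apply,
      LinearMap.compr₂_apply, LinearMap.smul_apply, LinearMap.id_apply, ← word_cons, stuffle_word]
    rw [stuffleWord]
  simpa using LinearMap.congr_fun₂ key P Q

theorem mergeLetters_comm (a b : Letter) : mergeLetters a b = mergeLetters b a := by
  simp [mergeLetters, add_comm]

theorem mergeLetters_assoc (a b c : Letter) :
    mergeLetters (mergeLetters a b) c = mergeLetters a (mergeLetters b c) := by
  simp [mergeLetters, index, y, add_assoc]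

theorem stuffle_comm_word (q : k) (n : ℕ) : ∀ u v : Word, u.length + v.length ≤ n →
    stuffle q (word k u) (word k v) = stuffle q (word k v) (word k u) := by
  induction n with
  | zero =>
    intro u v h
    obtain rfl : u = [] := List.length_eq_zero_iff.1 (by omega)
    obtain rfl : v = [] := List.length_eq_zero_iff.1 (by omega)
    rfl
  | succ n ih =>
    intro u v h
    cases u with
    | nil => rw [stuffle_nil_word, stuffle_word_nil]
    | cons a u =>
      cases v with
      | nil => rw [stuffle_nil_word, stuffle_word_nil]
      | cons b v =>
        simp only [List.length_cons] at h
        rw [word_cons a u, word_cons b v, stuffle_cons_cons, stuffle_cons_cons, ← word_cons,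
          ← word_cons, ih u (b :: v) (by simp; omega), ih (a :: u) v (by simp; omega),
          ih u v (by omega), mergeLetters_comm a b]
        abel

theorem stuffle_assoc_word (q : k) (n : ℕ) : ∀ u v w : Word, u.length + v.length + w.length ≤ n →
    stuffle q (stuffle q (word k u) (word k v)) (word k w) =
      stuffle q (word k u) (stuffle q (word k v) (word k w)) := by
  have h1 (P : Poly k) : stuffle q (word k []) P = P := by
    have : stuffle q (word k []) = LinearMap.id := poly_ext fun w => stuffle_nil_word q w
    rw [this]; rfl
  have h2 (P : Poly k) : stuffle q P (word k []) = P := by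
    have : (stuffle q).flip (word k []) = LinearMap.id := poly_ext fun w => stuffle_word_nil q w
    exact LinearMap.congr_fun this P
  induction n with
  | zero =>
    intro u v w h
    obtain rfl : u = [] := List.length_eq_zero_iff.1 (by omega)
    rw [h1, h1]
  | succ n ih =>
    intro u v w h
    cases u with
    | nil => rw [h1, h1]
    | cons a u =>
      cases v with
      | nil => rw [h1, h2]
      | cons b v =>
        cases w with
        | nil => rw [h2, h2]
        | cons c w =>
          simp only [List.length_cons] at h
          have e1 := ih u (b :: v) (c :: w) (by simp; omega)
          have e2 := ih (a :: u) v (c :: w) (by simp; omega)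
          have e3 := ih (a :: u) (b :: v) w (by simp; omega)
          have e4 := ih u v (c :: w) (by simp; omega)
          have e5 := ih u (b :: v) w (by simp; omega)
          have e6 := ih (a :: u) v w (by simp; omega)
          have e7 := ih u v w (by omega)
          simp only [word_cons a u, word_cons b v, word_cons c w] at *
          rw [stuffle_cons_cons q a b] at e3 ⊢
          rw [stuffle_cons_cons q b c] at e1 ⊢
          simp only [map_add, map_smul, LinearMap.add_apply, LinearMap.smul_apply,
            stuffle_cons_cons, smul_add, mergeLetters_assoc] at *
          rw [e2, e4, e5, e6, e7]
          have f1 := congrArg (fun X => word k [a] * X) e1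
          have f3 := congrArg (fun X => word k [c] * X) e3
          simp only [mul_add, mul_smul_comm] at f1 f3
          linear_combination (norm := module) f1 + f3


/-- The commutative `k`-algebra `(k⟨Y⟩, ⧢_q)`: the module `k⟨Y⟩` with the `q`-stuffle product. -/
def StuffleAlgebra (k : Type*) [CommRing k] (_q : k) : Type _ := Poly k

instance (q : k) : AddCommGroup (StuffleAlgebra k q) := inferInstanceAs (AddCommGroup (Poly k))

instance (q : k) : Module k (StuffleAlgebra k q) := inferInstanceAs (Module k (Poly k))

/-- The identity map of `k⟨Y⟩`, seen with values in `(k⟨Y⟩, ⧢_q)`. -/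
def toStuffle (q : k) : Poly k ≃ₗ[k] StuffleAlgebra k q := LinearEquiv.refl k (Poly k)

theorem stuffle_comm (q : k) (P Q : Poly k) : stuffle q P Q = stuffle q Q P := by
  have : stuffle q = (stuffle q).flip :=
    poly_ext fun u => poly_ext fun v => stuffle_comm_word q _ u v le_rfl
  exact LinearMap.congr_fun₂ this P Q

theorem stuffle_one (q : k) (P : Poly k) : stuffle q P 1 = P := by
  have : (stuffle q).flip (word k []) = LinearMap.id := poly_ext fun w => stuffle_word_nil q w
  exact LinearMap.congr_fun this P

theorem stuffle_assoc (q : k) (P Q R : Poly k) :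
    stuffle q (stuffle q P Q) R = stuffle q P (stuffle q Q R) := by
  have h1 (u v : Word) (R : Poly k) : stuffle q (stuffle q (word k u) (word k v)) R =
      stuffle q (word k u) (stuffle q (word k v) R) := by
    have : stuffle q (stuffle q (word k u) (word k v)) =
        stuffle q (word k u) ∘ₗ stuffle q (word k v) :=
      poly_ext fun w => stuffle_assoc_word q _ u v w le_rfl
    exact LinearMap.congr_fun this R
  have h2 (u : Word) (Q R : Poly k) : stuffle q (stuffle q (word k u) Q) R =
      stuffle q (word k u) (stuffle q Q R) := by
    have : (stuffle q).flip R ∘ₗ stuffle q (word k u) =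
        stuffle q (word k u) ∘ₗ (stuffle q).flip R := poly_ext fun v => h1 u v R
    exact LinearMap.congr_fun this Q
  have : (stuffle q).flip R ∘ₗ (stuffle q).flip Q = (stuffle q).flip (stuffle q Q R) :=
    poly_ext fun u => h2 u Q R
  exact LinearMap.congr_fun this P

instance (q : k) : CommRing (StuffleAlgebra k q) :=
  { (inferInstance : AddCommGroup (StuffleAlgebra k q)) with
    mul := fun P Q => toStuffle q (stuffle q ((toStuffle q).symm P) ((toStuffle q).symm Q))
    one := toStuffle q 1
    mul_assoc := stuffle_assoc q
    mul_comm := stuffle_comm q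
    mul_one := stuffle_one q
    one_mul := fun P => (stuffle_comm q 1 P).trans (stuffle_one q P)
    left_distrib := fun P Q R => map_add (stuffle q P) Q R
    right_distrib := fun P Q R => LinearMap.map_add₂ (stuffle q) P Q R
    zero_mul := fun P => LinearMap.map_zero₂ (stuffle q) P
    mul_zero := fun P => map_zero (stuffle q P) }

instance (q : k) : Algebra k (StuffleAlgebra k q) :=
  Algebra.ofModule (fun c P Q => LinearMap.map_smul₂ (stuffle q) c P Q)
    (fun c P Q => map_smul (stuffle q P) c Q)

open scoped TensorProduct

/-- `Δ(y_s) = y_s ⊗ 1 + 1 ⊗ y_s + q ∑_{s₁+s₂=s} y_{s₁} ⊗ y_{s₂}`, the sum over `s₁, s₂ ≥ 1`. -/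
def comulLetter (q : k) (a : Letter) : Poly k ⊗[k] Poly k :=
  word k [a] ⊗ₜ[k] 1 + 1 ⊗ₜ[k] word k [a]
    + q • ∑ p ∈ (Finset.Icc 1 (index a) ×ˢ Finset.Icc 1 (index a)).filter
        (fun p => p.1 + p.2 = index a), word k [y p.1] ⊗ₜ[k] word k [y p.2]

/-- The coproduct `Δ`: the morphism of algebras (for concatenation) given on letters by
`comulLetter`. -/
def comul (q : k) : Poly k →ₐ[k] Poly k ⊗[k] Poly k :=
  MonoidAlgebra.lift k (Poly k ⊗[k] Poly k) (FreeMonoid Letter) (FreeMonoid.lift (comulLetter q))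

/-- The module of primitive polynomials, `Δ P = P ⊗ 1 + 1 ⊗ P`. -/
def primitives (q : k) : Submodule k (Poly k) where
  carrier := {P | comul q P = P ⊗ₜ[k] 1 + 1 ⊗ₜ[k] P}
  add_mem' := by
    intro P Q hP hQ
    simp only [Set.mem_ofPred_eq] at *
    rw [map_add, hP, hQ, TensorProduct.add_tmul, TensorProduct.tmul_add]
    abel
  zero_mem' := by simp
  smul_mem' := by
    intro c P hP
    simp only [Set.mem_ofPred_eq] at *
    rw [map_smul, hP, smul_add, TensorProduct.smul_tmul', TensorProduct.tmul_smul]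

/-- `u₁ ⧢_q ⋯ ⧢_q u_k` for a list of words. -/
def stuffleList (q : k) (us : List Word) : Poly k :=
  us.foldr (fun u P => stuffle q (word k u) P) 1

/-- For a nonempty word `w`,
`π₁(w) = w + ∑_{k ≥ 2} ((-1)^(k-1) / k) ∑_{u₁, …, u_k ≠ 1} ⟨w | u₁ ⧢_q ⋯ ⧢_q u_k⟩ u₁ ⋯ u_k`.
Only finitely many terms are nonzero, see `finite_support_piOne`. -/
def piOne [Algebra ℚ k] (q : k) (w : Word) : Poly k :=
  word k w + ∑ᶠ us : {us : List Word // 2 ≤ us.length ∧ ∀ u ∈ us, u ≠ []},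
    (algebraMap ℚ k ((-1) ^ (us.1.length - 1) / us.1.length) * coeff (stuffleList q us.1) w) •
      word k us.1.flatten

/-- Polynomials homogeneous of weight `n`. -/
def homogeneous (k : Type*) [CommRing k] (n : ℕ) : Submodule k (Poly k) :=
  Submodule.span k {P | ∃ w, weight w = n ∧ P = word k w}

theorem word_mem (w : Word) : word k w ∈ homogeneous k (weight w) :=
  Submodule.subset_span ⟨w, rfl, rfl⟩

theorem coeff_eq_zero {n : ℕ} {P : Poly k} (hP : P ∈ homogeneous k n) {w : Word}
    (hw : weight w ≠ n) : coeff P w = 0 := by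
  induction hP using Submodule.span_induction with
  | mem P h =>
    obtain ⟨v, rfl, rfl⟩ := h
    have : v ≠ w := by rintro rfl; exact hw rfl
    simp [coeff, word, this]
  | zero => simp [coeff]
  | add P Q _ _ h1 h2 => simp_all [coeff]
  | smul c P _ h => simp_all [coeff]

theorem word_mul_mem {n : ℕ} {P : Poly k} (hP : P ∈ homogeneous k n) (a : Letter) :
    word k [a] * P ∈ homogeneous k (index a + n) := by
  induction hP using Submodule.span_induction with
  | mem P h =>
    obtain ⟨v, rfl, rfl⟩ := h
    rw [← word_cons]
    exact Submodule.subset_span ⟨a :: v, by simp [weight], rfl⟩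
  | zero => simp
  | add P Q _ _ h1 h2 => rw [mul_add]; exact add_mem h1 h2
  | smul c P _ h => rw [mul_smul_comm]; exact Submodule.smul_mem _ _ h

theorem stuffleWord_mem (q : k) (u v : Word) :
    stuffleWord q u v ∈ homogeneous k (weight u + weight v) := by
  fun_induction stuffleWord q u v with
  | case1 v => simpa [weight] using word_mem v
  | case2 u => simpa [weight] using word_mem u
  | case3 a u b v h1 h2 h3 =>
    have h1 := word_mul_mem h1 a
    have h2 := word_mul_mem h2 b
    have h3 := word_mul_mem h3 (mergeLetters a b)
    refine add_mem (add_mem ?_ ?_) (Submodule.smul_mem _ _ ?_)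
    · convert h1 using 2; simp only [weight_cons]; omega
    · convert h2 using 2; simp only [weight_cons]; omega
    · convert h3 using 2; simp only [weight_cons, index_mergeLetters]; omega

theorem stuffle_mem (q : k) (u : Word) {n : ℕ} {P : Poly k} (hP : P ∈ homogeneous k n) :
    stuffle q (word k u) P ∈ homogeneous k (weight u + n) := by
  induction hP using Submodule.span_induction with
  | mem P h =>
    obtain ⟨v, rfl, rfl⟩ := h
    rw [stuffle_word]; exact stuffleWord_mem q u v
  | zero => simp
  | add P Q _ _ h1 h2 => rw [map_add]; exact add_mem h1 h2
  | smul c P _ h => rw [map_smul]; exact Submodule.smul_mem _ _ h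

theorem stuffleList_mem (q : k) (us : List Word) :
    stuffleList q us ∈ homogeneous k (weight us.flatten) := by
  induction us with
  | nil => exact word_mem []
  | cons u us ih =>
    have := stuffle_mem q u ih
    rwa [← weight_append] at this

theorem finite_lists {β : Type*} {S : Set β} (hS : S.Finite) (n : ℕ) :
    {l : List β | l.length ≤ n ∧ ∀ x ∈ l, x ∈ S}.Finite := by
  have : Finite S := hS
  refine ((List.finite_length_le S n).image (List.map Subtype.val)).subset ?_
  rintro l ⟨h1, h2⟩
  lift l to List S using h2
  exact ⟨l, by simpa using h1, rfl⟩

theorem length_le_weight (w : Word) : w.length ≤ weight w := by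
  induction w with
  | nil => simp
  | cons a w ih =>
    have : 0 < (index a : ℕ) := (index a).pos
    rw [weight_cons, List.length_cons]
    omega

theorem finite_words (n : ℕ) : {w : Word | weight w ≤ n}.Finite := by
  have hS : {a : Letter | (index a : ℕ) ≤ n}.Finite := by
    refine Set.Finite.of_finite_image (f := fun a => (index a : ℕ)) ((Set.finite_Iic n).subset ?_) ?_
    · rintro _ ⟨a, ha, rfl⟩; exact ha
    · intro a _ b _ h; exact PNat.coe_injective h
  refine (finite_lists hS n).subset fun w hw => ⟨(length_le_weight w).trans hw, fun a ha => ?_⟩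
  exact (List.single_le_sum (fun x _ => Nat.zero_le x) _ (List.mem_map_of_mem ha)).trans hw

theorem finite_support_piOne [Algebra ℚ k] (q : k) (w : Word) :
    (Function.support fun us : {us : List Word // 2 ≤ us.length ∧ ∀ u ∈ us, u ≠ []} =>
      (algebraMap ℚ k ((-1) ^ (us.1.length - 1) / us.1.length) * coeff (stuffleList q us.1) w) •
        word k us.1.flatten).Finite := by
  refine Set.Finite.of_finite_image (f := Subtype.val)
    ((finite_lists (finite_words (weight w)) (weight w)).subset ?_) Subtype.val_injective.injOn
  rintro _ ⟨⟨us, h1, h2⟩, hus, rfl⟩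
  have hw : weight w = weight us.flatten := by
    by_contra h
    exact hus (by simp [coeff_eq_zero (stuffleList_mem q us) h])
  rw [Set.mem_ofPred_eq, hw, weight_flatten]
  constructor
  · have := List.card_nsmul_le_sum (us.map weight) 1 (by
      intro x hx
      obtain ⟨u, hu, rfl⟩ := List.mem_map.1 hx
      exact (List.length_pos_iff.2 (h2 u hu)).trans_le (length_le_weight u))
    simpa using this
  · intro u hu
    exact List.single_le_sum (fun x _ => Nat.zero_le x) _ (List.mem_map_of_mem hu)

/-- `Π_l` for a Lyndon word `l`: `Π_{y_s} = π₁(y_s)`, and `Π_l = [Π_s, Π_r]` if `l` has length at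
least two and standard factorization `(s, r)`. -/
def lyndonPi [Algebra ℚ k] (q : k) (w : Word) : Poly k :=
  if _h : 2 ≤ w.length then
    lyndonPi q (stdLeft w) * lyndonPi q (stdRight w)
      - lyndonPi q (stdRight w) * lyndonPi q (stdLeft w)
  else piOne q w
termination_by w.length
decreasing_by
  all_goals
    have h := stdIndex_spec w _h
    simp only [stdLeft, stdRight, List.length_take, List.length_drop]
    omega

/-- `Π_w = Π_{l₁} ⋯ Π_{lₙ}` for `w = l₁ ⋯ lₙ` with Lyndon words `l₁ ≥ ⋯ ≥ lₙ`. -/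
def wordPi [Algebra ℚ k] (q : k) (w : Word) : Poly k :=
  ((lyndonFactorization w).map (lyndonPi q)).prod

/-- `S` is the family `(Σ_w)` dual to `(Π_w)`: `⟨Σ_v | Π_u⟩ = δ_{u,v}`. -/
def IsDualFamily [Algebra ℚ k] (q : k) (S : Word → Poly k) : Prop :=
  ∀ u v : Word, pairing (S v) (wordPi q u) = if u = v then 1 else 0

end
end QStuffle

namespace QStuffle

/-! ### Lyndon words and the standard factorization -/

section Lyndon
variable {α : Type*} [LinearOrder α]

/-! Two facts about the `Π_w` drive everything: they are unitriangular over words, and the `Π_l` are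
primitive.

Triangularity (`leads_wordPi`): `Π_w` is `w` plus lexicographically greater words of the same
weight. For a letter this holds because `π₁(y_s)` otherwise involves only words whose first letter
has smaller index. It survives products, and it survives the bracket because `l'l'' < l''l'` for the
standard factorization of a Lyndon word. Each weight carries finitely many words, so `(Π_w)` is a
basis, homogeneous for the weight, and its dual family `(Σ_w)` consists of genuine polynomials.

Primitivity: `Δ` is the transpose of the `q`-stuffle (`pairL_stuffle`), so a polynomial without
constant term is primitive as soon as it is orthogonal to all products of two nonempty words. The
coefficient of `v` in `π₁(y_s)` is `(-q)^(|v|-1) / |v|` when `v` has weight `s`, and zero otherwise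
(`coeff_piOne`). Since `(-1)^(j-1) / j` is the linear coefficient of `X choose j`, and the length
count of a quasi-shuffle expands `(X choose m)(X choose n)` in binomials, orthogonality says that a
product of two polynomials without constant term has no linear term (`logL_lengthPoly`). Brackets of
primitives are primitive, which gives all `Π_l`.

Index words by multisets of Lyndon words. As `Δ` is multiplicative and the `Π_l` are primitive, `Δ
Π_m` is the sum of `Π_a ⊗ Π_b` over the splittings `m = a + b`, counted with multiplicity. Dually,
`Σ_a ⧢_q Σ_b` is a positive integer times `Σ_{a+b}` (`stuffle_sigma`). These integers are invertible
in a `ℚ`-algebra, so the monomials in the `Σ_l` are the `Σ_w` up to units, and the algebra is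
polynomial in the `Σ_l`. The same formula shows that a primitive `P` pairs to zero with every `Σ_w`
for `w` not Lyndon, so `P` lies in the span of the `Π_l`. -/

theorem lyndonFactorization_spec (w : List α) :
    IsLyndonFactorization w (lyndonFactorization w) :=
  (exists_lyndonFactorization w).choose_spec

theorem IsLyndonFactorization.eq {w : List α} {ls : List (List α)}
    (h : IsLyndonFactorization w ls) : lyndonFactorization w = ls :=
  lyndonFactorization_unique _ w _ (lyndonFactorization_spec w) h

theorem IsLyndon.factorization {l : List α} (h : IsLyndon l) : lyndonFactorization l = [l] :=
  IsLyndonFactorization.eq ⟨by simpa using h, by simp, by simp⟩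

theorem IsLyndonFactorization.append {u v : List α} {ls ms : List (List α)}
    (hu : IsLyndonFactorization u ls) (hv : IsLyndonFactorization v ms)
    (h : ∀ l ∈ ls, ∀ m ∈ ms, m ≤ l) : IsLyndonFactorization (u ++ v) (ls ++ ms) := by
  refine ⟨fun l hl => ?_, List.pairwise_append.2 ⟨hu.2.1, hv.2.1, h⟩, ?_⟩
  · rcases List.mem_append.1 hl with hl | hl
    · exact hu.1 l hl
    · exact hv.1 l hl
  · rw [List.flatten_append, hu.2.2, hv.2.2]

theorem stdLeft_append_stdRight (w : List α) : stdLeft w ++ stdRight w = w :=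
  List.take_append_drop _ _

theorem not_isLyndon_of_length_lt {w v : List α} (hv : v <:+ w)
    (h1 : (stdRight w).length < v.length) (h2 : v.length < w.length) : ¬ IsLyndon v := by
  intro h
  obtain ⟨u, rfl⟩ := hv
  have hu : 0 < u.length := by simp at h2; omega
  have : stdIndex (u ++ v) ≤ u.length := Nat.sInf_le ⟨hu, by simpa using h⟩
  simp [stdRight] at h1
  omega

theorem isLyndon_stdRight {w : List α} (h : 2 ≤ w.length) : IsLyndon (stdRight w) :=
  (stdIndex_spec w h).2.2

/-- Let `m` be the last Lyndon factor of the left part, and suppose it is not the only one. If `m <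
stdRight w`, then `m ++ stdRight w` is a Lyndon proper right factor longer than `stdRight w`.
Otherwise appending `stdRight w` gives a factorization of `w` with several factors, against
uniqueness. -/
theorem isLyndon_stdLeft {w : List α} (hw : IsLyndon w) (h : 2 ≤ w.length) :
    IsLyndon (stdLeft w) := by
  obtain ⟨h1, h2, h3⟩ := stdIndex_spec w h
  have hr : IsLyndon (stdRight w) := h3
  have hlr := stdLeft_append_stdRight w
  have hl : stdLeft w ≠ [] := by
    intro h0
    have h4 : (w.take (stdIndex w)).length = 0 := congrArg List.length h0
    rw [List.length_take] at h4
    omega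
  obtain ⟨g1, g2, g3⟩ := lyndonFactorization_spec (stdLeft w)
  rcases List.eq_nil_or_concat (lyndonFactorization (stdLeft w)) with h0 | ⟨ms, m, h0⟩
  · rw [h0] at g3; exact absurd g3.symm hl
  · rw [List.concat_eq_append] at h0
    rw [h0] at g1 g2 g3
    have hm := g1 m (by simp)
    rcases eq_or_ne ms [] with rfl | hms
    · simp at g3; rwa [← g3]
    · exfalso
      obtain ⟨m', ms', rfl⟩ := List.exists_cons_of_ne_nil hms
      have hm' := List.length_pos_iff.2 (g1 m' (by simp)).1
      have hmp := List.length_pos_iff.2 hm.1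
      by_cases hlt : m < stdRight w
      · refine not_isLyndon_of_length_lt (w := w) (v := m ++ stdRight w)
          ⟨(m' :: ms').flatten, ?_⟩ ?_ ?_ (hm.append hr hlt)
        · conv_rhs => rw [← hlr, ← g3]
          simp
        · simp; omega
        · have := congrArg List.length hlr
          rw [← g3] at this
          simp at this ⊢; omega
      · have hr' : IsLyndonFactorization (stdRight w) [stdRight w] :=
          ⟨by simpa using hr, by simp, by simp⟩
        have hf := IsLyndonFactorization.append ⟨g1, g2, g3⟩ hr' (by
          intro l hl x hx
          obtain rfl := List.mem_singleton.1 hx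
          refine (not_lt.1 hlt).trans ?_
          rcases List.mem_append.1 hl with hl | hl
          · exact (List.pairwise_append.1 g2).2.2 l hl m (by simp)
          · rw [List.mem_singleton.1 hl])
        rw [hlr] at hf
        have := hf.eq.symm.trans hw.factorization
        simpa using congrArg List.length this

end Lyndon

/-! ### Unitriangularity of the `Π_w` over words -/

noncomputable section Triangular
variable {k : Type*} [CommRing k]

/-- The span of the words of the same weight as `w` that are greater than `w`. -/
def above (k : Type*) [CommRing k] (w : Word) : Submodule k (Poly k) :=
  Submodule.span k {P | ∃ v, weight v = weight w ∧ w < v ∧ P = word k v}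

/-- `P` is `w` plus greater words of the same weight. -/
def Leads (w : Word) (P : Poly k) : Prop := P - word k w ∈ above k w

/-- A proper prefix has strictly smaller weight, so words of equal weight are compared at an actual
letter and right factors cannot change the outcome. This is why `above` fixes the weight. -/
theorem append_lt_append_left {u u' : Word} (hw : weight u' = weight u) (h : u < u') (v v' : Word) :
    u ++ v < u' ++ v' := by
  refine append_lt_append_of_lt h ?_ v v'
  rintro ⟨t, rfl⟩
  rw [weight_append] at hw
  have := length_le_weight t
  obtain rfl : t = [] := List.length_eq_zero_iff.1 (by omega)
  simp at h

theorem above_mul_word {u : Word} {P : Poly k} (hP : P ∈ above k u) {v v' : Word}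
    (hv : weight v' = weight v) : P * word k v' ∈ above k (u ++ v) := by
  induction hP using Submodule.span_induction with
  | mem P h =>
    obtain ⟨x, hx1, hx2, rfl⟩ := h
    rw [← word_append]
    exact Submodule.subset_span ⟨_, by simp [weight_append, hx1, hv],
      append_lt_append_left hx1 hx2 _ _, rfl⟩
  | zero => simp
  | add P Q _ _ h1 h2 => rw [add_mul]; exact add_mem h1 h2
  | smul c P _ h => rw [smul_mul_assoc]; exact Submodule.smul_mem _ _ h

theorem word_mul_above (u : Word) {v : Word} {P : Poly k} (hP : P ∈ above k v) :
    word k u * P ∈ above k (u ++ v) := by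
  induction hP using Submodule.span_induction with
  | mem P h =>
    obtain ⟨x, hx1, hx2, rfl⟩ := h
    rw [← word_append]
    exact Submodule.subset_span ⟨_, by simp [weight_append, hx1], append_left_lt u hx2, rfl⟩
  | zero => simp
  | add P Q _ _ h1 h2 => rw [mul_add]; exact add_mem h1 h2
  | smul c P _ h => rw [mul_smul_comm]; exact Submodule.smul_mem _ _ h

theorem above_mul_above {u v : Word} {P Q : Poly k} (hP : P ∈ above k u) (hQ : Q ∈ above k v) :
    P * Q ∈ above k (u ++ v) := by
  induction hQ using Submodule.span_induction with
  | mem Q h =>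
    obtain ⟨x, hx1, hx2, rfl⟩ := h
    exact above_mul_word hP hx1
  | zero => simp
  | add Q R _ _ h1 h2 => rw [mul_add]; exact add_mem h1 h2
  | smul c Q _ h => rw [mul_smul_comm]; exact Submodule.smul_mem _ _ h

theorem Leads.mul {u v : Word} {P Q : Poly k} (hP : Leads u P) (hQ : Leads v Q) :
    Leads (u ++ v) (P * Q) := by
  have h : P * Q - word k (u ++ v) = (P - word k u) * (Q - word k v)
      + word k u * (Q - word k v) + (P - word k u) * word k v := by
    rw [word_append]; noncomm_ring
  rw [Leads, h]
  exact add_mem (add_mem (above_mul_above hP hQ) (word_mul_above u hQ)) (above_mul_word hP rfl)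

theorem above_le {u v : Word} (hw : weight v = weight u) (h : u ≤ v) : above k v ≤ above k u := by
  refine Submodule.span_mono ?_
  rintro _ ⟨x, hx1, hx2, rfl⟩
  exact ⟨x, hx1.trans hw, h.trans_lt hx2, rfl⟩

theorem Leads.mem_above {u v : Word} {P : Poly k} (hP : Leads v P) (hw : weight v = weight u)
    (h : u < v) : P ∈ above k u := by
  have : P = (P - word k v) + word k v := by abel
  rw [this]
  exact add_mem (above_le hw h.le hP) (Submodule.subset_span ⟨v, hw, h, rfl⟩)

theorem Leads.bracket {u v : Word} {P Q : Poly k} (hP : Leads u P) (hQ : Leads v Q)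
    (h : u ++ v < v ++ u) : Leads (u ++ v) (P * Q - Q * P) := by
  have e : P * Q - Q * P - word k (u ++ v) = (P * Q - word k (u ++ v)) - Q * P := by abel
  rw [Leads, e]
  exact sub_mem (hP.mul hQ) ((hQ.mul hP).mem_above (by simp [weight_append, add_comm]) h)

theorem leads_word (w : Word) : Leads w (word k w) := by simp [Leads]

theorem leads_prod (ls : List Word) (f : Word → Poly k) (h : ∀ l ∈ ls, Leads l (f l)) :
    Leads ls.flatten (ls.map f).prod := by
  induction ls with
  | nil => exact leads_word []
  | cons l ls ih =>
    rw [List.flatten_cons, List.map_cons, List.prod_cons]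
    exact (h l (by simp)).mul (ih fun x hx => h x (by simp [hx]))

theorem Leads.mem_homogeneous {w : Word} {P : Poly k} (h : Leads w P) :
    P ∈ homogeneous k (weight w) := by
  have : P = (P - word k w) + word k w := by abel
  rw [this]
  refine add_mem (Submodule.span_mono ?_ h) (word_mem w)
  rintro _ ⟨v, hv, _, rfl⟩
  exact ⟨v, hv, rfl⟩

theorem coeff_word (v w : Word) : coeff (word k v) w = if v = w then 1 else 0 := by
  classical
  rw [coeff, word, MonoidAlgebra.coeff_single, Finsupp.single_apply]
  exact if_congr Iff.rfl rfl rfl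

/-- `coeff` as a linear form. -/
def coeffL (k : Type*) [CommRing k] (w : Word) : Poly k →ₗ[k] k where
  toFun P := coeff P w
  map_add' P Q := by simp [coeff]
  map_smul' c P := by simp [coeff]

@[simp] theorem coeffL_apply (w : Word) (P : Poly k) : coeffL k w P = coeff P w := rfl

theorem coeff_eq_zero_of_mem_above {w v : Word} {P : Poly k} (hP : P ∈ above k w) (h : ¬ w < v) :
    coeff P v = 0 := by
  have : above k w ≤ LinearMap.ker (coeffL k v) := by
    refine Submodule.span_le.2 ?_
    rintro _ ⟨x, _, hx2, rfl⟩
    have : x ≠ v := by rintro rfl; exact h hx2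
    simp [coeff_word, this]
  exact this hP

theorem Leads.coeff_eq {w v : Word} {P : Poly k} (hP : Leads w P) (h : ¬ w < v) :
    coeff P v = if w = v then 1 else 0 := by
  have := coeff_eq_zero_of_mem_above hP h
  rw [← coeffL_apply, map_sub, coeffL_apply, coeffL_apply, coeff_word] at this
  exact sub_eq_zero.1 this

/-- At the least word of the support of a relation, only the corresponding `f u` has a nonzero
coefficient, namely `1`. -/
theorem Leads.linearIndependent {f : Word → Poly k} (h : ∀ w, Leads w (f w)) :
    LinearIndependent k f := by
  rw [linearIndependent_iff]
  intro c hc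
  by_contra hne
  have hs : c.support.Nonempty := Finsupp.support_nonempty_iff.2 hne
  set u := c.support.min' hs with hu
  have hmem : u ∈ c.support := Finset.min'_mem _ hs
  have h0 := congrArg (coeffL k u) hc
  rw [Finsupp.linearCombination_apply, Finsupp.sum, map_sum, map_zero,
    Finset.sum_eq_single u] at h0
  · rw [map_smul, coeffL_apply, (h u).coeff_eq (lt_irrefl _), if_pos rfl, smul_eq_mul,
      mul_one] at h0
    exact Finsupp.mem_support_iff.1 hmem h0
  · intro v hv hvu
    have hle : u ≤ v := Finset.min'_le _ _ hv
    rw [map_smul, coeffL_apply, (h v).coeff_eq hle.not_gt, if_neg hvu, smul_zero]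
  · intro h; exact absurd hmem h

/-- Descending induction inside the finite set of words of a given weight. The restriction to that
weight is what later makes the dual family finitely supported. -/
theorem Leads.word_mem_span {f : Word → Poly k} (h : ∀ w, Leads w (f w)) (w : Word) :
    word k w ∈ Submodule.span k (f '' {v | weight v = weight w}) := by
  have hfin : {v : Word | weight v = weight w}.Finite :=
    (finite_words (weight w)).subset fun v hv => le_of_eq hv
  -- The induction parameter bounds the number of greater words of the same weight; it drops when
  -- `u` is replaced by a greater word.
  have key : ∀ n : ℕ, ∀ u : Word, weight u = weight w →
      {v : Word | weight v = weight w ∧ u < v}.ncard < n →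
      word k u ∈ Submodule.span k (f '' {v | weight v = weight w}) := by
    intro n
    induction n with
    | zero => intro u _ h; omega
    | succ n ih =>
      intro u hu hn
      have e : word k u = f u - (f u - word k u) := by abel
      rw [e]
      refine sub_mem (Submodule.subset_span ⟨u, hu, rfl⟩) ?_
      refine (Submodule.span_le (p := Submodule.span k (f '' {v | weight v = weight w}))).2 ?_ (h u)
      rintro _ ⟨v, hv, huv, rfl⟩
      refine ih v (hv.trans hu) (lt_of_lt_of_le (Set.ncard_lt_ncard ?_
        (hfin.subset fun x hx => hx.1)) (Nat.lt_succ_iff.1 hn))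
      refine ⟨fun x hx => ⟨hx.1, huv.trans hx.2⟩, fun hsub => ?_⟩
      exact lt_irrefl v (hsub ⟨hv.trans hu, huv⟩).2
  exact key _ w rfl (Nat.lt_succ_self _)

theorem span_word_eq_top : Submodule.span k (Set.range (word k)) = ⊤ := by
  have := (MonoidAlgebra.basis (FreeMonoid Letter) k).span_eq
  rw [← this]
  rfl

theorem Leads.span_eq_top {f : Word → Poly k} (h : ∀ w, Leads w (f w)) :
    Submodule.span k (Set.range f) = ⊤ := by
  rw [← top_le_iff, ← span_word_eq_top, Submodule.span_le]
  rintro _ ⟨w, rfl⟩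
  exact Submodule.span_mono (Set.image_subset_range _ _) (Leads.word_mem_span h w)

variable [Algebra ℚ k]

/-- A concatenation of at least two nonempty words of total weight `s` begins with a letter of index
less than `s`, which is a greater letter since the order on `Y` is reversed. -/
theorem leads_piOne (q : k) (a : Letter) : Leads [a] (piOne q [a]) := by
  rw [Leads, piOne, add_sub_cancel_left]
  refine finsum_induction (· ∈ above k [a]) (zero_mem _) (fun _ _ => add_mem) ?_
  rintro ⟨us, h1, h2⟩
  by_cases hw : weight [a] = weight us.flatten
  · refine Submodule.smul_mem _ _ (Submodule.subset_span ⟨_, hw.symm, ?_, rfl⟩)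
    match us, h1, h2, hw with
    | u :: v :: us, _, h2, hw =>
      obtain ⟨b, u', rfl⟩ := List.exists_cons_of_ne_nil (h2 u (by simp))
      have hv := (List.length_pos_iff.2 (h2 v (by simp))).trans_le (length_le_weight v)
      simp only [List.flatten_cons, weight_append, weight_cons, weight_nil] at hw
      have hlt : index b < index a := by
        rw [← PNat.coe_lt_coe]; omega
      rw [List.flatten_cons, List.cons_append, List.cons_lt_cons_iff]
      exact Or.inl hlt
  · rw [coeff_eq_zero (stuffleList_mem q us) hw, mul_zero, zero_smul]
    exact zero_mem _

theorem leads_lyndonPi (q : k) (n : ℕ) : ∀ l : Word, l.length ≤ n → IsLyndon l →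
    Leads l (lyndonPi q l) := by
  induction n with
  | zero => intro l h hl; exact absurd (List.length_eq_zero_iff.1 (by omega)) hl.1
  | succ n ih =>
    intro l h hl
    unfold lyndonPi
    split_ifs with h2
    · obtain ⟨i1, i2, i3⟩ := stdIndex_spec l h2
      have e := stdLeft_append_stdRight l
      have hL : (stdLeft l).length = stdIndex l := by simp [stdLeft]; omega
      have hR : (stdRight l).length = l.length - stdIndex l := by simp [stdRight]
      have hr := isLyndon_stdRight h2
      have hs := isLyndon_stdLeft hl h2
      have b1 := ih _ (by omega) hs
      have b2 := ih _ (by omega) hr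
      -- A Lyndon word is smaller than its right factor, which is a prefix of the swapped word.
      have hlt : stdLeft l ++ stdRight l < stdRight l ++ stdLeft l := by
        rw [e]
        exact (hl.2 _ _ hs.1 hr.1 e.symm).trans_le (le_of_prefix ⟨_, rfl⟩)
      have := b1.bracket b2 hlt
      rwa [e] at this
    · have h1 := List.length_pos_iff.2 hl.1
      obtain ⟨a, rfl⟩ := List.length_eq_one_iff.1 (show l.length = 1 by omega)
      exact leads_piOne q a

theorem leads_wordPi (q : k) (w : Word) : Leads w (wordPi q w) := by
  obtain ⟨h1, h2, h3⟩ := lyndonFactorization_spec w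
  have := leads_prod (lyndonFactorization w) (lyndonPi q)
    fun l hl => leads_lyndonPi q _ l le_rfl (h1 l hl)
  rwa [h3] at this

/-- The family `(Π_w)` as a basis of `k⟨Y⟩`. -/
def basisPi (q : k) : Module.Basis Word k (Poly k) :=
  Module.Basis.mk (Leads.linearIndependent (leads_wordPi q))
    (Leads.span_eq_top (leads_wordPi q)).ge

@[simp] theorem basisPi_apply (q : k) (w : Word) : basisPi q w = wordPi q w := by
  simp [basisPi]

end Triangular
end QStuffle

namespace QStuffle

/-! ### Duality between the coproduct and the `q`-stuffle -/

noncomputable section Duality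
variable {k : Type*} [CommRing k]

/-- `pairing` as a bilinear map. -/
def pairL (k : Type*) [CommRing k] : Poly k →ₗ[k] Poly k →ₗ[k] k :=
  LinearMap.mk₂ k pairing
    (fun P P' Q => by
      simp only [pairing, MonoidAlgebra.coeff_add]
      exact Finsupp.sum_add_index' (by simp) (by simp [add_mul]))
    (fun c P Q => by
      simp only [pairing, MonoidAlgebra.coeff_smul, smul_eq_mul]
      rw [Finsupp.sum_smul_index (by simp), Finsupp.mul_sum]
      simp [mul_assoc])
    (fun P Q Q' => by simp [pairing, mul_add, Finsupp.sum_add])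
    (fun c P Q => by simp [pairing, Finsupp.mul_sum, mul_left_comm])

theorem pairL_apply (P Q : Poly k) : pairL k P Q = pairing P Q := rfl

theorem pairL_word_left (u : Word) (Q : Poly k) : pairL k (word k u) Q = coeff Q u := by
  simp [pairL_apply, pairing, word, coeff]

theorem pairL_word_right (P : Poly k) (w : Word) : pairL k P (word k w) = coeff P w := by
  have : (pairL k).flip (word k w) = coeffL k w := poly_ext fun u => by
    rw [LinearMap.flip_apply, pairL_word_left, coeffL_apply, coeff_word, coeff_word]
    exact if_congr eq_comm rfl rfl
  exact LinearMap.congr_fun this P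

theorem coeff_word_mul_nil (c : Letter) (P : Poly k) : coeff (word k [c] * P) [] = 0 := by
  have : coeffL k [] ∘ₗ LinearMap.mulLeft k (word k [c]) = 0 := poly_ext fun u => by
    simp [← word_cons, coeff_word]
  exact LinearMap.congr_fun this P

theorem coeff_word_mul_cons (c a : Letter) (u : Word) (P : Poly k) :
    coeff (word k [c] * P) (a :: u) = if c = a then coeff P u else 0 := by
  split_ifs with h
  · subst h
    have : coeffL k (c :: u) ∘ₗ LinearMap.mulLeft k (word k [c]) = coeffL k u :=
      poly_ext fun v => by simp [← word_cons, coeff_word]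
    exact LinearMap.congr_fun this P
  · have : coeffL k (a :: u) ∘ₗ LinearMap.mulLeft k (word k [c]) = 0 := poly_ext fun v => by
      simp [← word_cons, coeff_word, h]
    exact LinearMap.congr_fun this P

open scoped TensorProduct

/-- The linear form `X ↦ ⟨P ⊗ Q | X⟩`. -/
def tensorPair (P Q : Poly k) : Poly k ⊗[k] Poly k →ₗ[k] k :=
  LinearMap.mul' k k ∘ₗ TensorProduct.map (pairL k P) (pairL k Q)

@[simp] theorem tensorPair_tmul (P Q R S : Poly k) :
    tensorPair P Q (R ⊗ₜ S) = pairL k P R * pairL k Q S := by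
  simp [tensorPair]

theorem tensorPair_word_left (c : Letter) (u v : Word) (X : Poly k ⊗[k] Poly k) :
    tensorPair (word k u) (word k v) ((word k [c] ⊗ₜ 1) * X) =
      match u with
      | [] => 0
      | a :: u => if c = a then tensorPair (word k u) (word k v) X else 0 := by
  induction X with
  | zero => cases u <;> simp
  | tmul x y =>
    cases u <;> simp [pairL_word_left, coeff_word_mul_nil, coeff_word_mul_cons]
  | add X Y h1 h2 =>
    rw [mul_add, map_add, h1, h2]
    cases u
    · simp
    · dsimp only; split_ifs <;> simp

theorem tensorPair_word_right (c : Letter) (u v : Word) (X : Poly k ⊗[k] Poly k) :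
    tensorPair (word k u) (word k v) ((1 ⊗ₜ word k [c]) * X) =
      match v with
      | [] => 0
      | b :: v => if c = b then tensorPair (word k u) (word k v) X else 0 := by
  induction X with
  | zero => cases v <;> simp
  | tmul x y =>
    cases v <;> simp [pairL_word_left, coeff_word_mul_nil, coeff_word_mul_cons]
  | add X Y h1 h2 =>
    rw [mul_add, map_add, h1, h2]
    cases v
    · simp
    · dsimp only; split_ifs <;> simp

theorem tmul_word_word (c d : Letter) :
    (word k [c] ⊗ₜ[k] word k [d] : Poly k ⊗[k] Poly k) =
      (word k [c] ⊗ₜ 1) * (1 ⊗ₜ word k [d]) := by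
  simp

theorem comul_word_singleton (q : k) (c : Letter) : comul q (word k [c]) = comulLetter q c := by
  simp [comul, word]

theorem word_nil : word k [] = 1 := rfl

/-- Only the summand formed by the first letters of `u` and `v` can contribute, and it occurs
exactly when these letters merge to `c`. -/
theorem tensorPair_merge (c : Letter) (u v : Word) (X : Poly k ⊗[k] Poly k) :
    tensorPair (word k u) (word k v) ((∑ p ∈ (Finset.Icc 1 (index c) ×ˢ Finset.Icc 1 (index c)).filter
        (fun p => p.1 + p.2 = index c), word k [y p.1] ⊗ₜ[k] word k [y p.2]) * X) =
      match u, v with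
      | a :: u, b :: v =>
        if mergeLetters a b = c then tensorPair (word k u) (word k v) X else 0
      | _, _ => 0 := by
  rw [Finset.sum_mul, map_sum]
  simp only [tmul_word_word, mul_assoc, tensorPair_word_left, tensorPair_word_right]
  match u, v with
  | [], _ => simp
  | a :: u, [] => simp
  | a :: u, b :: v =>
    dsimp only
    have h1 : ∀ p : ℕ+ × ℕ+, (if y p.1 = a then if y p.2 = b then
        tensorPair (word k u) (word k v) X else 0 else 0) =
        if p = (index a, index b) then tensorPair (word k u) (word k v) X else 0 := by
      intro p
      rw [← ite_and]
      exact if_congr (Prod.ext_iff (x := p) (y := (index a, index b))).symm rfl rfl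
    rw [Finset.sum_congr rfl fun p _ => h1 p, Finset.sum_ite_eq']
    refine if_congr ?_ rfl rfl
    rw [Finset.mem_filter, Finset.mem_product, Finset.mem_Icc, Finset.mem_Icc]
    refine ⟨fun h => congrArg OrderDual.toDual h.2, fun h => ?_⟩
    have h2 : index a + index b = index c := congrArg OrderDual.ofDual h
    rw [← h2]
    exact ⟨⟨⟨one_le, (PNat.lt_add_right _ _).le⟩,
      ⟨one_le, (PNat.lt_add_left _ _).le⟩⟩, rfl⟩

/-- Since `Δ(cw) = Δ(c)Δ(w)`, the three kinds of terms in `Δ(c)` match the three terms of the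
stuffle recursion. -/
theorem tensorPair_comul_word (q : k) (w : Word) : ∀ u v : Word,
    tensorPair (word k u) (word k v) (comul q (word k w)) = coeff (stuffleWord q u v) w := by
  induction w with
  | nil =>
    intro u v
    rw [word_nil, map_one, Algebra.TensorProduct.one_def, tensorPair_tmul, pairL_word_left,
      pairL_word_left, ← word_nil, coeff_word, coeff_word]
    match u, v with
    | [], v => simp [stuffleWord, coeff_word, eq_comm]
    | a :: u, [] => simp [stuffleWord, coeff_word]
    | a :: u, b :: v =>
      rw [stuffleWord, ← coeffL_apply, map_add, map_add, map_smul]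
      simp [coeff_word_mul_nil]
  | cons c w ih =>
    intro u v
    rw [word_cons, map_mul, comul_word_singleton, comulLetter, add_mul, add_mul, map_add, map_add,
      tensorPair_word_left, tensorPair_word_right, smul_mul_assoc, map_smul, tensorPair_merge]
    match u, v with
    | [], [] => simp [stuffleWord, coeff_word]
    | [], b :: v =>
      simp [stuffleWord, coeff_word, ih, ite_and, eq_comm]
    | a :: u, [] =>
      have : stuffleWord q u [] = word k u := by cases u <;> simp [stuffleWord]
      simp [stuffleWord, coeff_word, ih, ite_and, eq_comm, this]
    | a :: u, b :: v =>
      rw [stuffleWord, ← coeffL_apply, map_add, map_add, map_smul]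
      simp [coeff_word_mul_cons, ih, eq_comm]

theorem pairL_stuffle (q : k) (P Q R : Poly k) :
    pairL k (stuffle q P Q) R = tensorPair P Q (comul q R) := by
  have h1 (u v : Word) (R : Poly k) : pairL k (stuffle q (word k u) (word k v)) R =
      tensorPair (word k u) (word k v) (comul q R) := by
    have : pairL k (stuffle q (word k u) (word k v)) =
        tensorPair (word k u) (word k v) ∘ₗ (comul q).toLinearMap := poly_ext fun w => by
      rw [LinearMap.comp_apply, AlgHom.toLinearMap_apply, tensorPair_comul_word, pairL_word_right,
        stuffle_word]
    exact LinearMap.congr_fun this R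
  let T : Poly k →ₗ[k] Poly k →ₗ[k] k := LinearMap.mk₂ k (fun P Q => tensorPair P Q (comul q R))
    (fun P P' Q => by simp [tensorPair, TensorProduct.map_add_left])
    (fun c P Q => by simp [tensorPair, TensorProduct.map_smul_left])
    (fun P Q Q' => by simp [tensorPair, TensorProduct.map_add_right])
    (fun c P Q => by simp [tensorPair, TensorProduct.map_smul_right])
  have h2 : (stuffle q).compr₂ ((pairL k).flip R) = T :=
    poly_ext fun u => poly_ext fun v => h1 u v R
  exact LinearMap.congr_fun₂ h2 P Q

theorem ext_coeff {P Q : Poly k} (h : ∀ w, coeff P w = coeff Q w) : P = Q := by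
  refine MonoidAlgebra.ext (Finsupp.ext fun w => ?_)
  exact h (FreeMonoid.toList w)

/-- The forms `tensorPair` on pairs of words are the coordinates of the tensor product of the word
bases. -/
theorem tensor_ext {X Y : Poly k ⊗[k] Poly k}
    (h : ∀ u v, tensorPair (word k u) (word k v) X = tensorPair (word k u) (word k v) Y) :
    X = Y := by
  let b := (MonoidAlgebra.basis (FreeMonoid Letter) k).tensorProduct
    (MonoidAlgebra.basis (FreeMonoid Letter) k)
  refine b.ext_elem fun ⟨u, v⟩ => ?_
  have key : b.coord (u, v) =
      tensorPair (word k (FreeMonoid.toList u)) (word k (FreeMonoid.toList v)) := by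
    refine TensorProduct.ext' fun x y => ?_
    simp only [tensorPair_tmul, pairL_word_left, Module.Basis.coord_apply]
    rw [Module.Basis.tensorProduct_repr_tmul_apply]
    exact mul_comm _ _
  have := h (FreeMonoid.toList u) (FreeMonoid.toList v)
  rw [← key] at this
  exact this

/-- `P` is primitive if its constant term is zero and it is orthogonal to the products of
nonempty words. -/
theorem mem_primitives (q : k) {P : Poly k} (h0 : coeff P [] = 0)
    (h : ∀ u v : Word, u ≠ [] → v ≠ [] → pairL k P (stuffle q (word k u) (word k v)) = 0) :
    P ∈ primitives q := by
  have hsymm (A B : Poly k) : pairL k A B = pairL k B A := by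
    have : pairL k = (pairL k).flip := poly_ext fun u => LinearMap.ext fun Q => by
      rw [LinearMap.flip_apply, pairL_word_left, pairL_word_right]
    exact LinearMap.congr_fun₂ this A B
  refine tensor_ext fun u v => ?_
  rw [← pairL_stuffle, map_add, tensorPair_tmul, tensorPair_tmul]
  simp only [pairL_word_left, ← word_nil, coeff_word]
  by_cases hu : u = []
  · subst hu
    rw [stuffle_nil_word, pairL_word_left, h0]
    simp
  · by_cases hv : v = []
    · subst hv
      rw [stuffle_word_nil, pairL_word_left, h0]
      simp
    · rw [hsymm, h u v hu hv]
      simp [Ne.symm hu, Ne.symm hv]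

end Duality
end QStuffle

namespace QStuffle

/-! ### Binomial polynomials, and primitivity of `π₁` on letters -/

noncomputable section Eulerian

open Polynomial

/-- The coefficient of `X ^ j` counts the words of length `j` in the quasi-shuffle (`q = 1`) of a
word of length `m` with a word of length `n`. -/
def lengthPoly : ℕ → ℕ → ℚ[X]
  | 0, n => X ^ n
  | m + 1, 0 => X ^ (m + 1)
  | m + 1, n + 1 => X * (lengthPoly m (n + 1) + lengthPoly (m + 1) n + lengthPoly m n)

/-- The binomial coefficient `X choose j` as a polynomial. -/
def binomPoly (j : ℕ) : ℚ[X] := C ((j.factorial : ℚ)⁻¹) * descPochhammer ℚ j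

theorem eval_binomPoly (t j : ℕ) : (binomPoly j).eval (t : ℚ) = t.choose j := by
  rw [binomPoly, eval_mul, eval_C, descPochhammer_eval_eq_descFactorial,
    Nat.descFactorial_eq_factorial_mul_choose, Nat.cast_mul, inv_mul_cancel_left₀]
  exact_mod_cast j.factorial_ne_zero

theorem coeff_zero_binomPoly (j : ℕ) : (binomPoly (j + 1)).coeff 0 = 0 := by
  have := eval_binomPoly 0 (j + 1)
  rw [coeff_zero_eq_eval_zero]
  simpa using this

theorem binomPoly_succ (j : ℕ) :
    binomPoly (j + 1) = C ((j + 1 : ℚ)⁻¹) * (binomPoly j * (X - C (j : ℚ))) := by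
  rw [binomPoly, binomPoly, descPochhammer_succ_right, Nat.factorial_succ, Nat.cast_mul, mul_inv,
    C_mul]
  simp only [Nat.cast_add, Nat.cast_one, map_natCast]
  ring

/-- This is the source of the logarithmic coefficients of `π₁`. For `j = 0` both sides vanish, the
right one because division by zero gives zero. -/
theorem coeff_one_binomPoly (j : ℕ) : (binomPoly j).coeff 1 = (-1) ^ (j - 1) / j := by
  induction j with
  | zero => simp [binomPoly, coeff_one]
  | succ j ih =>
    rw [binomPoly_succ, coeff_C_mul, mul_sub, coeff_sub, coeff_mul_X, coeff_mul_C, ih]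
    cases j with
    | zero => simp [binomPoly]
    | succ j =>
      rw [coeff_zero_binomPoly]
      have h1 : ((j + 1 : ℕ) : ℚ) ≠ 0 := by positivity
      have h2 : ((j + 1 : ℕ) : ℚ) + 1 ≠ 0 := by positivity
      simp only [Nat.add_sub_cancel]
      push_cast at *
      field_simp
      ring

/-- The linear map `X ^ j ↦ (X choose j)`. -/
def binomL : ℚ[X] →ₗ[ℚ] ℚ[X] := (Polynomial.basisMonomials ℚ).constr ℚ binomPoly

theorem binomL_X_pow (j : ℕ) : binomL (X ^ j) = binomPoly j := by
  have := (Polynomial.basisMonomials ℚ).constr_basis ℚ binomPoly j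
  rw [Polynomial.coe_basisMonomials] at this
  simpa only [Polynomial.monomial_one_right_eq_X_pow, ← binomL.eq_1] using this

/-- The linear form `X ^ j ↦ (t choose j)`. -/
def chooseL (t : ℕ) : ℚ[X] →ₗ[ℚ] ℚ := Polynomial.leval (t : ℚ) ∘ₗ binomL

theorem chooseL_X_pow (t j : ℕ) : chooseL t (X ^ j) = t.choose j := by
  rw [chooseL, LinearMap.comp_apply, binomL_X_pow, Polynomial.leval_apply, eval_binomPoly]

theorem linearMap_ext_X_pow {M : Type*} [AddCommMonoid M] [Module ℚ M] {f g : ℚ[X] →ₗ[ℚ] M}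
    (h : ∀ j, f (X ^ j) = g (X ^ j)) : f = g := by
  refine (Polynomial.basisMonomials ℚ).ext fun j => ?_
  rw [Polynomial.coe_basisMonomials]
  simpa only [Polynomial.monomial_one_right_eq_X_pow] using h j

theorem chooseL_zero_X_mul (p : ℚ[X]) : chooseL 0 (X * p) = 0 := by
  have : chooseL 0 ∘ₗ LinearMap.mulLeft ℚ X = 0 := linearMap_ext_X_pow fun j => by
    simp [← pow_succ', chooseL_X_pow]
  exact LinearMap.congr_fun this p

theorem chooseL_succ_X_mul (t : ℕ) (p : ℚ[X]) :
    chooseL (t + 1) (X * p) = chooseL t (X * p) + chooseL t p := by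
  have : chooseL (t + 1) ∘ₗ LinearMap.mulLeft ℚ X =
      chooseL t ∘ₗ LinearMap.mulLeft ℚ X + chooseL t := linearMap_ext_X_pow fun j => by
    simp [← pow_succ', chooseL_X_pow, Nat.choose_succ_succ, add_comm]
  exact LinearMap.congr_fun this p

/-- Pairs of an `m`-subset and an `n`-subset of a `t`-set, sorted by the size of their union, are
counted by quasi-shuffles. The induction on `t` is Pascal's rule applied to both sides. -/
theorem chooseL_lengthPoly (t : ℕ) : ∀ m n : ℕ,
    chooseL t (lengthPoly m n) = t.choose m * t.choose n := by
  induction t with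
  | zero =>
    intro m n
    match m, n with
    | 0, n => simp [lengthPoly, chooseL_X_pow]
    | m + 1, 0 => simp [lengthPoly, chooseL_X_pow]
    | m + 1, n + 1 => simp [lengthPoly, chooseL_zero_X_mul]
  | succ t ih =>
    intro m n
    match m, n with
    | 0, n => simp [lengthPoly, chooseL_X_pow]
    | m + 1, 0 => simp [lengthPoly, chooseL_X_pow]
    | m + 1, n + 1 =>
      have := ih (m + 1) (n + 1)
      rw [lengthPoly] at this ⊢
      rw [chooseL_succ_X_mul, this, map_add, map_add, ih, ih, ih, Nat.choose_succ_succ,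
        Nat.choose_succ_succ]
      push_cast
      ring

/-- Both polynomials agree at every natural number. -/
theorem binomL_lengthPoly (m n : ℕ) : binomL (lengthPoly m n) = binomPoly m * binomPoly n := by
  refine Polynomial.eq_of_infinite_eval_eq _ _ ?_
  refine (Set.infinite_range_of_injective (Nat.cast_injective (R := ℚ))).mono ?_
  rintro _ ⟨t, rfl⟩
  have := chooseL_lengthPoly t m n
  rw [chooseL, LinearMap.comp_apply, Polynomial.leval_apply] at this
  rw [Set.mem_ofPred_eq, this, eval_mul, eval_binomPoly, eval_binomPoly]

/-- The linear form `X ^ j ↦ (-1) ^ (j - 1) / j`. -/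
def logL : ℚ[X] →ₗ[ℚ] ℚ := Polynomial.lcoeff ℚ 1 ∘ₗ binomL

theorem logL_X_pow (j : ℕ) : logL (X ^ j) = (-1) ^ (j - 1) / j := by
  rw [logL, LinearMap.comp_apply, binomL_X_pow, Polynomial.lcoeff_apply, coeff_one_binomPoly]

theorem logL_lengthPoly (m n : ℕ) : logL (lengthPoly (m + 1) (n + 1)) = 0 := by
  rw [logL, LinearMap.comp_apply, binomL_lengthPoly, Polynomial.lcoeff_apply, mul_coeff_one,
    coeff_zero_binomPoly, coeff_zero_binomPoly]
  simp

variable {k : Type*} [CommRing k]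

/-- Each merge costs one letter and brings a factor `q`, so the total power of `q` is constant and
only lengths matter. `L` and `f` are universally quantified because the induction replaces them by
their composites with multiplication by `X` and by a letter. -/
theorem apply_stuffleWord [Algebra ℚ k] (q : k) (u v : Word) : ∀ (L : ℚ[X] →ₗ[ℚ] k) (f : Poly k →ₗ[k] k),
    (∀ w : Word, f (word k w) = q ^ w.length * L (X ^ w.length)) →
    f (stuffleWord q u v) = q ^ (u.length + v.length) * L (lengthPoly u.length v.length) := by
  fun_induction stuffleWord q u v with
  | case1 v => intro L f h; simp [h, lengthPoly]
  | case2 u =>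
    intro L f h
    cases u <;> simp [h, lengthPoly]
  | case3 a u b v h1 h2 h3 =>
    intro L f h
    have key (c : Letter) (w : Word) : (f ∘ₗ LinearMap.mulLeft k (word k [c])) (word k w) =
        q ^ w.length * (LinearMap.mulLeft ℚ q ∘ₗ L ∘ₗ LinearMap.mulLeft ℚ X) (X ^ w.length) := by
      simp only [LinearMap.comp_apply, LinearMap.mulLeft_apply]
      rw [← word_cons, h, List.length_cons, pow_succ q, pow_succ' X, mul_assoc]
    have e1 := h1 _ _ (key a)
    have e2 := h2 _ _ (key b)
    have e3 := h3 _ _ (key (mergeLetters a b))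
    simp only [LinearMap.comp_apply, LinearMap.mulLeft_apply] at e1 e2 e3
    simp only [List.length_cons, lengthPoly, map_add, map_smul, mul_add, smul_eq_mul] at *
    rw [e1, e2, e3]
    ring

theorem coeff_stuffleWord_nil (q : k) (u v : Word) :
    coeff (stuffleWord q u v) [] = if u = [] ∧ v = [] then 1 else 0 := by
  rw [← tensorPair_comul_word, word_nil, map_one, Algebra.TensorProduct.one_def, tensorPair_tmul,
    pairL_word_left, pairL_word_left, ← word_nil, coeff_word, coeff_word]
  simp [← ite_and, eq_comm, and_comm]

/-- A product of two nonempty words contains a one-letter word only by merging two single letters.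
-/
theorem coeff_stuffle_singleton (q : k) (u : Word) (hu : u ≠ []) (a : Letter) (P : Poly k)
    (hP : coeff P [] = 0) (h : u.length ≠ 1 ∨ ¬ ∃ c d, u = [c] ∧ mergeLetters c d = a) :
    coeff (stuffle q (word k u) P) [a] = 0 := by
  have key : coeffL k [a] ∘ₗ stuffle q (word k u) = coeff (word k u) [a] • coeffL k [] := by
    refine poly_ext fun v => ?_
    rw [LinearMap.comp_apply, stuffle_word, coeffL_apply, LinearMap.smul_apply, coeffL_apply]
    match u, v, hu with
    | c :: u, [], _ => simp [stuffleWord, coeff_word]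
    | c :: u, b :: v, _ =>
      rw [stuffleWord, ← coeffL_apply, map_add, map_add, map_smul]
      simp only [coeffL_apply, coeff_word_mul_cons, coeff_stuffleWord_nil, coeff_word]
      have : ¬ (mergeLetters c b = a ∧ u = [] ∧ v = []) := by
        rintro ⟨h1, rfl, rfl⟩
        rcases h with h | h
        · simp at h
        · exact h ⟨c, b, rfl, h1⟩
      simp
      tauto
  have := LinearMap.congr_fun key P
  rwa [LinearMap.smul_apply, coeffL_apply, hP, smul_zero] at this

theorem coeff_stuffle_letter (q : k) (c d : Letter) (P : Poly k) :
    coeff (stuffle q (word k [c]) P) [mergeLetters c d] = q * coeff P [d] := by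
  have hc : c ≠ mergeLetters c d := by
    intro h
    have h1 := congrArg (fun a => (index a : ℕ)) h
    have h2 := (index d).pos
    simp only [index_mergeLetters] at h1
    omega
  have hinj (b : Letter) : mergeLetters c b = mergeLetters c d ↔ b = d := by
    refine ⟨fun h => ?_, fun h => h ▸ rfl⟩
    have h1 := congrArg (fun a => (index a : ℕ)) h
    simp only [index_mergeLetters] at h1
    have h2 : (index b : ℕ) = index d := by omega
    exact PNat.coe_injective h2
  have key : coeffL k [mergeLetters c d] ∘ₗ stuffle q (word k [c]) = q • coeffL k [d] := by
    refine poly_ext fun v => ?_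
    rw [LinearMap.comp_apply, stuffle_word, coeffL_apply, LinearMap.smul_apply, coeffL_apply]
    match v with
    | [] => simp [stuffleWord, coeff_word, hc]
    | b :: v =>
      rw [stuffleWord, ← coeffL_apply, map_add, map_add, map_smul]
      simp only [coeffL_apply, coeff_word_mul_cons, coeff_stuffleWord_nil, coeff_word, hinj]
      simp [ite_and]
  exact LinearMap.congr_fun key P

theorem coeff_stuffleList_nil (q : k) {us : List Word} (hus : us ≠ []) (h : ∀ u ∈ us, u ≠ []) :
    coeff (stuffleList q us) [] = 0 := by
  refine coeff_eq_zero (stuffleList_mem q us) ?_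
  obtain ⟨u, us, rfl⟩ := List.exists_cons_of_ne_nil hus
  have := (List.length_pos_iff.2 (h u (by simp))).trans_le (length_le_weight u)
  rw [weight_nil, List.flatten_cons, weight_append]
  omega

/-- To reach a single letter all factors must be letters and all must be merged, at the cost of one
`q` per merge. -/
theorem coeff_stuffleList_singleton (q : k) (us : List Word) : ∀ a : Letter, us ≠ [] →
    (∀ u ∈ us, u ≠ []) → coeff (stuffleList q us) [a] =
      if (∀ u ∈ us, u.length = 1) ∧ weight us.flatten = index a then q ^ (us.length - 1) else 0 := by
  induction us with
  | nil => intro a h; exact absurd rfl h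
  | cons u us ih =>
    intro a _ hne
    have hu := hne u (by simp)
    have hus : ∀ u ∈ us, u ≠ [] := fun x hx => hne x (by simp [hx])
    rcases eq_or_ne us [] with rfl | h0
    · have : stuffleList q [u] = word k u := stuffle_one q _
      rw [this, coeff_word]
      refine if_congr ?_ (by simp) rfl
      constructor
      · rintro rfl; simp [weight]
      · rintro ⟨h1, h2⟩
        obtain ⟨c, rfl⟩ := List.length_eq_one_iff.1 (h1 u (by simp))
        have : (index c : ℕ) = index a := by simpa [weight] using h2
        rw [show c = a from PNat.coe_injective this]
    · have hnil := coeff_stuffleList_nil q h0 hus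
      change coeff (stuffle q (word k u) (stuffleList q us)) [a] = _
      by_cases h : ∃ c d, u = [c] ∧ mergeLetters c d = a
      · obtain ⟨c, d, rfl, rfl⟩ := h
        rw [coeff_stuffle_letter, ih d h0 hus, mul_ite, mul_zero]
        refine if_congr ?_ ?_ rfl
        · simp [weight_cons, index_mergeLetters]
        · have := List.length_pos_iff.2 h0
          rw [← pow_succ', List.length_cons]
          congr 1
          omega
      · rw [coeff_stuffle_singleton q u hu a _ hnil (Or.inr h), if_neg]
        rintro ⟨h1, h2⟩
        obtain ⟨c, rfl⟩ := List.length_eq_one_iff.1 (h1 u (by simp))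
        obtain ⟨v, us', rfl⟩ := List.exists_cons_of_ne_nil h0
        have h3 := (List.length_pos_iff.2 (hus v (by simp))).trans_le (length_le_weight v)
        simp only [List.flatten_cons, weight_append, weight_cons, weight_nil] at h2
        have hlt : index c < index a := by rw [← PNat.coe_lt_coe]; omega
        refine h ⟨c, y (index a - index c), rfl, ?_⟩
        exact congrArg OrderDual.toDual (PNat.add_sub_of_lt hlt)

theorem coeff_piOne [Algebra ℚ k] (q : k) (a : Letter) (v : Word) : coeff (piOne q [a]) v =
    if weight v = index a then q ^ (v.length - 1) * algebraMap ℚ k (logL (X ^ v.length)) else 0 := by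
  rw [piOne, ← coeffL_apply, map_add, map_finsum (coeffL k v) (finite_support_piOne q [a]),
    coeffL_apply, coeff_word, logL_X_pow]
  simp only [map_smul, coeffL_apply, coeff_word, smul_eq_mul]
  have hflat : (v.map fun c => [c]).flatten = v := by
    induction v <;> simp_all
  have huniq : ∀ us : List Word, (∀ u ∈ us, u.length = 1) → us.flatten = v →
      us = v.map fun c => [c] := by
    rintro us h1 rfl
    induction us with
    | nil => rfl
    | cons u us ih =>
      obtain ⟨c, rfl⟩ := List.length_eq_one_iff.1 (h1 u (by simp))
      rw [List.flatten_cons, List.map_append, ← ih (fun x hx => h1 x (by simp [hx])) (by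
        clear ih h1
        induction us <;> simp_all)]
      rfl
  by_cases hv : 2 ≤ v.length
  · have hva : [a] ≠ v := by rintro rfl; simp at hv
    -- The only contributing factorization of `v` is the one into its letters.
    rw [if_neg hva, zero_add, finsum_eq_single _ ⟨v.map fun c => [c], by simpa using hv, by simp⟩]
    · have hne : v.map (fun c => [c]) ≠ [] := by
        intro h; rw [List.map_eq_nil_iff.1 h] at hv; simp at hv
      simp only [hflat, if_true, mul_one, List.length_map]
      rw [coeff_stuffleList_singleton q _ a hne (by simp), hflat, mul_ite, mul_zero, mul_comm]
      exact if_congr (by simp) (by simp) rfl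
    · rintro ⟨us, h1, h2⟩ h3
      have hne : us ≠ [] := by rintro rfl; simp at h1
      simp only
      rw [coeff_stuffleList_singleton q _ a hne h2]
      split_ifs with h4 h5
      · exact absurd (Subtype.ext (huniq us h4.1 h5)) h3
      all_goals simp
  · rw [finsum_eq_zero_of_forall_eq_zero, add_zero]
    · match v, hv with
      | [], _ => simp [weight_nil]
      | [b], _ =>
        refine if_congr ?_ (by simp) rfl
        simp only [List.cons.injEq, and_true, weight_cons, weight_nil, add_zero]
        exact ⟨fun h => h ▸ rfl, fun h => (PNat.coe_injective h).symm⟩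
      | b :: c :: v, hv => simp at hv
    · rintro ⟨us, h1, h2⟩
      have hne : us ≠ [] := by rintro rfl; simp at h1
      simp only
      rw [coeff_stuffleList_singleton q _ a hne h2]
      split_ifs with h4 h5
      · exfalso
        have := huniq us h4.1 h5
        rw [this, List.length_map] at h1
        exact hv h1
      all_goals simp

theorem piOne_mem_primitives [Algebra ℚ k] (q : k) (a : Letter) : piOne q [a] ∈ primitives q := by
  have h0 : (0 : ℕ) ≠ index a := (index a).pos.ne
  refine mem_primitives q (by rw [coeff_piOne, weight_nil, if_neg h0]) fun u v hu hv => ?_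
  obtain ⟨b, u, rfl⟩ := List.exists_cons_of_ne_nil hu
  obtain ⟨c, v, rfl⟩ := List.exists_cons_of_ne_nil hv
  rw [stuffle_word]
  let g : Poly k →ₗ[k] k := (MonoidAlgebra.basis (FreeMonoid Letter) k).constr k fun w =>
    q ^ ((FreeMonoid.toList w).length - 1) *
      algebraMap ℚ k (logL (X ^ (FreeMonoid.toList w).length))
  have hg (w : Word) : g (word k w) = q ^ (w.length - 1) * algebraMap ℚ k (logL (X ^ w.length)) :=
    (MonoidAlgebra.basis (FreeMonoid Letter) k).constr_basis k _ (FreeMonoid.ofList w)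
  have hP {n : ℕ} {Q : Poly k} (hQ : Q ∈ homogeneous k n) :
      pairL k (piOne q [a]) Q = if n = index a then g Q else 0 := by
    induction hQ using Submodule.span_induction with
    | mem Q h =>
      obtain ⟨w, rfl, rfl⟩ := h
      rw [pairL_word_right, coeff_piOne, hg]
    | zero => simp
    | add P Q _ _ h1 h2 => rw [map_add, h1, h2, map_add]; split_ifs <;> simp
    | smul r P _ h => rw [map_smul, h, map_smul]; split_ifs <;> simp
  rw [hP (stuffleWord_mem q _ _)]
  split_ifs
  -- Stripping the first letter from each word of the product turns `q ^ (|w| - 1)` into `q ^ |w|`,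
  -- the form required by `apply_stuffleWord`, so `q` is never inverted.
  · let L : ℚ[X] →ₗ[ℚ] k := (Algebra.linearMap ℚ k) ∘ₗ logL ∘ₗ LinearMap.mulLeft ℚ X
    have key (d : Letter) (w : Word) : (g ∘ₗ LinearMap.mulLeft k (word k [d])) (word k w) =
        q ^ w.length * L (X ^ w.length) := by
      simp only [LinearMap.comp_apply, LinearMap.mulLeft_apply, L]
      rw [← word_cons, hg, List.length_cons, Nat.add_sub_cancel, pow_succ' X]
      rfl
    have e1 := apply_stuffleWord q u (c :: v) _ _ (key b)
    have e2 := apply_stuffleWord q (b :: u) v _ _ (key c)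
    have e3 := apply_stuffleWord q u v _ _ (key (mergeLetters b c))
    have e := logL_lengthPoly u.length v.length
    rw [lengthPoly, mul_add, mul_add, map_add, map_add] at e
    have e' := congrArg (algebraMap ℚ k) e
    simp only [map_add, map_zero] at e'
    rw [stuffleWord, map_add, map_add, map_smul]
    simp only [LinearMap.comp_apply, LinearMap.mulLeft_apply, L, Algebra.linearMap_apply,
      List.length_cons, smul_eq_mul] at *
    rw [e1, e2, e3]
    linear_combination q ^ (u.length + v.length + 1) * e'
  · rfl

theorem bracket_mem_primitives (q : k) {P Q : Poly k} (hP : P ∈ primitives q)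
    (hQ : Q ∈ primitives q) : P * Q - Q * P ∈ primitives q := by
  have h1 : comul q P = P ⊗ₜ[k] 1 + 1 ⊗ₜ[k] P := hP
  have h2 : comul q Q = Q ⊗ₜ[k] 1 + 1 ⊗ₜ[k] Q := hQ
  change comul q (P * Q - Q * P) = _
  rw [map_sub, map_mul, map_mul, h1, h2]
  simp only [add_mul, mul_add, Algebra.TensorProduct.tmul_mul_tmul, one_mul, mul_one,
    TensorProduct.sub_tmul, TensorProduct.tmul_sub]
  abel

theorem lyndonPi_mem_primitives [Algebra ℚ k] (q : k) (n : ℕ) : ∀ l : Word, l.length ≤ n → l ≠ [] →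
    lyndonPi q l ∈ primitives q := by
  induction n with
  | zero => intro l h hl; exact absurd (List.length_eq_zero_iff.1 (by omega)) hl
  | succ n ih =>
    intro l h hl
    have hl' := List.length_pos_iff.2 hl
    unfold lyndonPi
    split_ifs with h2
    · obtain ⟨i1, i2, i3⟩ := stdIndex_spec l h2
      have hL : (stdLeft l).length = stdIndex l := by simp [stdLeft]; omega
      have hR : (stdRight l).length = l.length - stdIndex l := by simp [stdRight]
      exact bracket_mem_primitives q
        (ih _ (by omega) (List.length_pos_iff.1 (by omega)))
        (ih _ (by omega) (List.length_pos_iff.1 (by omega)))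
    · obtain ⟨a, rfl⟩ := List.length_eq_one_iff.1 (show l.length = 1 by omega)
      exact piOne_mem_primitives q a

end Eulerian
end QStuffle

namespace QStuffle

/-! ### Multisets of Lyndon words, the dual basis and the polynomial structure -/

noncomputable section Multisets
variable {k : Type*} [CommRing k]

/-- The type of Lyndon words. -/
abbrev LyndonWord : Type := {l : Word // IsLyndon l}

/-- The word `l₁ ⋯ lₙ`, where `l₁ ≥ ⋯ ≥ lₙ` are the elements of the multiset. -/
def toWord (m : Multiset LyndonWord) : Word := ((m.sort (· ≥ ·)).map Subtype.val).flatten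

theorem lyndonFactorization_toWord (m : Multiset LyndonWord) :
    lyndonFactorization (toWord m) = (m.sort (· ≥ ·)).map Subtype.val := by
  refine IsLyndonFactorization.eq ⟨?_, ?_, rfl⟩
  · intro l hl
    obtain ⟨x, _, rfl⟩ := List.mem_map.1 hl
    exact x.2
  · exact List.pairwise_map.2 (m.pairwise_sort (· ≥ ·))

/-- Words correspond to multisets of Lyndon words. -/
def multisetEquivWord : Multiset LyndonWord ≃ Word :=
  Equiv.ofBijective toWord ⟨fun m m' h => by
    have h1 := congrArg lyndonFactorization h
    rw [lyndonFactorization_toWord, lyndonFactorization_toWord] at h1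
    have h2 := List.map_injective_iff.2 Subtype.val_injective h1
    rw [← m.sort_eq (· ≥ ·), h2, Multiset.sort_eq], fun w => by
    obtain ⟨h1, h2, h3⟩ := lyndonFactorization_spec w
    lift lyndonFactorization w to List LyndonWord using h1 with ls
    refine ⟨ls, ?_⟩
    have : (ls : Multiset LyndonWord).sort (· ≥ ·) = ls := by
      rw [Multiset.coe_sort]
      refine List.mergeSort_eq_self _ ((List.pairwise_map.1 h2).imp fun h => ?_)
      simpa using h
    rw [toWord, this, h3]⟩

@[simp] theorem multisetEquivWord_apply (m : Multiset LyndonWord) :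
    multisetEquivWord m = toWord m := rfl

theorem toWord_zero : toWord 0 = [] := by simp [toWord]

theorem toWord_singleton (l : LyndonWord) : toWord {l} = l.1 := by simp [toWord]

variable [Algebra ℚ k]

/-- The ordered product of the `Π_l` over a multiset of Lyndon words. -/
def multisetPi (q : k) (m : Multiset LyndonWord) : Poly k := wordPi q (toWord m)

theorem multisetPi_zero (q : k) : multisetPi q 0 = 1 := by
  rw [multisetPi, wordPi, lyndonFactorization_toWord]; simp

theorem multisetPi_singleton (q : k) (l : LyndonWord) : multisetPi q {l} = lyndonPi q l.1 := by
  rw [multisetPi, wordPi, lyndonFactorization_toWord]; simp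

theorem multisetPi_cons (q : k) (l : LyndonWord) (m : Multiset LyndonWord) (h : ∀ x ∈ m, x ≤ l) :
    multisetPi q (l ::ₘ m) = lyndonPi q l.1 * multisetPi q m := by
  rw [multisetPi, multisetPi, wordPi, wordPi, lyndonFactorization_toWord,
    lyndonFactorization_toWord, Multiset.sort_cons _ _ _ h]
  simp

open scoped TensorProduct

/-- Each factor `Π_l ⊗ 1 + 1 ⊗ Π_l` sends `l` to one side. Peeling off the greatest Lyndon word
keeps both sides in non-increasing order, so no reordering of the `Π_l` is needed. -/
theorem comul_multisetPi_coe (q : k) (ls : List LyndonWord) (h : ls.Pairwise (· ≥ ·)) :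
    comul q (multisetPi q ls) = ((Multiset.antidiagonal (ls : Multiset LyndonWord)).map
      fun p => multisetPi q p.1 ⊗ₜ[k] multisetPi q p.2).sum := by
  induction ls with
  | nil => simp [multisetPi_zero, Algebra.TensorProduct.one_def]
  | cons l ls ih =>
    obtain ⟨h1, h2⟩ := List.pairwise_cons.1 h
    have hl : comul q (lyndonPi q l.1) = lyndonPi q l.1 ⊗ₜ[k] 1 + 1 ⊗ₜ[k] lyndonPi q l.1 :=
      lyndonPi_mem_primitives q _ l.1 le_rfl l.2.1
    rw [← Multiset.cons_coe, multisetPi_cons q l ls (by simpa using h1), map_mul, ih h2, hl,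
      Multiset.antidiagonal_cons, Multiset.map_add, Multiset.sum_add, add_mul, add_comm,
      Multiset.map_map, Multiset.map_map, ← Multiset.sum_map_mul_left, ← Multiset.sum_map_mul_left]
    congr 2 <;> refine Multiset.map_congr rfl fun p hp => ?_
    all_goals
      rw [Multiset.mem_antidiagonal] at hp
      have h3 (x : LyndonWord) (hx : x ∈ p.1 + p.2) : x ≤ l := by
        rw [hp] at hx; exact h1 x (by simpa using hx)
    · simp [multisetPi_cons q l p.2 fun x hx => h3 x (Multiset.mem_add.2 (Or.inr hx))]
    · simp [multisetPi_cons q l p.1 fun x hx => h3 x (Multiset.mem_add.2 (Or.inl hx))]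

theorem comul_multisetPi (q : k) (m : Multiset LyndonWord) :
    comul q (multisetPi q m) = ((Multiset.antidiagonal m).map
      fun p => multisetPi q p.1 ⊗ₜ[k] multisetPi q p.2).sum := by
  have := comul_multisetPi_coe q (m.sort (· ≥ ·)) (m.pairwise_sort _)
  rwa [Multiset.sort_eq] at this

/-- The coordinate form at `w` lives in a single weight, hence on finitely many words, and is
therefore represented by a polynomial. -/
theorem coord_word_eq_zero (q : k) {u w : Word} (h : weight u ≠ weight w) :
    (basisPi q).coord w (word k u) = 0 := by
  have : Submodule.span k (wordPi q '' {v | weight v = weight u}) ≤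
      LinearMap.ker ((basisPi q).coord w) := by
    refine Submodule.span_le.2 ?_
    rintro _ ⟨v, hv, rfl⟩
    have hvw : v ≠ w := by rintro rfl; exact h hv.symm
    rw [SetLike.mem_coe, LinearMap.mem_ker, ← basisPi_apply, Module.Basis.coord_apply,
      Module.Basis.repr_self, Finsupp.single_eq_of_ne hvw.symm]
  exact this (Leads.word_mem_span (leads_wordPi q) u)

theorem finite_weight_eq (n : ℕ) : {w : Word | weight w = n}.Finite :=
  (finite_words n).subset fun _ hw => le_of_eq hw

/-- The dual family `(Σ_w)`. -/
def sigma (q : k) (w : Word) : Poly k :=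
  ∑ u ∈ (finite_weight_eq (weight w)).toFinset, (basisPi q).coord w (word k u) • word k u

theorem pairL_sigma (q : k) (w : Word) : pairL k (sigma q w) = (basisPi q).coord w := by
  refine poly_ext fun u => ?_
  rw [pairL_word_right, ← coeffL_apply, sigma, map_sum]
  simp only [map_smul, coeffL_apply, coeff_word, smul_eq_mul, mul_ite, mul_one, mul_zero]
  rw [Finset.sum_ite_eq']
  split_ifs with h
  · rfl
  · rw [coord_word_eq_zero]
    simpa using h

theorem pairL_sigma_wordPi (q : k) (u v : Word) :
    pairL k (sigma q v) (wordPi q u) = if u = v then 1 else 0 := by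
  rw [pairL_sigma, ← basisPi_apply, Module.Basis.coord_apply, Module.Basis.repr_self,
    Finsupp.single_apply]

theorem isDualFamily_sigma (q : k) : IsDualFamily q (sigma q) := pairL_sigma_wordPi q

theorem ext_pairL_wordPi (q : k) {P Q : Poly k}
    (h : ∀ w, pairL k P (wordPi q w) = pairL k Q (wordPi q w)) : P = Q := by
  have : pairL k P = pairL k Q := (basisPi q).ext fun w => by simpa using h w
  exact ext_coeff fun w => by rw [← pairL_word_right, ← pairL_word_right, this]

theorem IsDualFamily.eq_sigma {q : k} {S : Word → Poly k} (h : IsDualFamily q S) :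
    S = sigma q := by
  funext v
  exact ext_pairL_wordPi q fun u => (h u v).trans (pairL_sigma_wordPi q u v).symm

theorem linearIndependent_sigma (q : k) : LinearIndependent k (sigma q) := by
  rw [linearIndependent_iff]
  intro c hc
  ext u
  have := congrArg (fun P => pairL k P (wordPi q u)) hc
  simpa [Finsupp.linearCombination_apply, Finsupp.sum, LinearMap.sum_apply,
    pairL_sigma_wordPi] using this

theorem span_sigma (q : k) : Submodule.span k (Set.range (sigma q)) = ⊤ := by
  rw [← top_le_iff, ← span_word_eq_top, Submodule.span_le]
  rintro _ ⟨w, rfl⟩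
  -- Expansion in the dual basis; homogeneity of `Π_u` confines it to the weight of `w`.
  have : word k w = ∑ u ∈ (finite_weight_eq (weight w)).toFinset,
      coeff (wordPi q u) w • sigma q u := by
    refine ext_pairL_wordPi q fun v => ?_
    rw [pairL_word_left, map_sum, LinearMap.sum_apply]
    simp only [map_smul, LinearMap.smul_apply, pairL_sigma_wordPi, smul_eq_mul, mul_ite, mul_one,
      mul_zero]
    rw [Finset.sum_ite_eq]
    split_ifs with h
    · rfl
    · refine coeff_eq_zero (leads_wordPi q v).mem_homogeneous ?_
      rw [Set.Finite.mem_toFinset] at h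
      exact fun h' => h h'.symm
  rw [SetLike.mem_coe, this]
  exact sum_mem fun u _ => Submodule.smul_mem _ _ (Submodule.subset_span ⟨u, rfl⟩)

/-- The family `(Σ_w)` as a basis of the `q`-stuffle algebra. -/
def basisSigma (q : k) : Module.Basis Word k (StuffleAlgebra k q) :=
  (Module.Basis.mk (linearIndependent_sigma q) (span_sigma q).ge).map (toStuffle q)

theorem basisSigma_apply (q : k) (w : Word) : basisSigma q w = toStuffle q (sigma q w) := by
  simp [basisSigma]

open scoped Classical in
-- Transpose of `comul_multisetPi`: pairing with `Π_m` counts the occurrences of `(a, b)` among the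
-- splittings of `m`, which forces `m = a + b`.
theorem stuffle_sigma (q : k) (a b : Multiset LyndonWord) :
    stuffle q (sigma q (toWord a)) (sigma q (toWord b)) =
      (((a + b).antidiagonal.count (a, b) : ℕ) : k) • sigma q (toWord (a + b)) := by
  refine ext_pairL_wordPi q fun w => ?_
  obtain ⟨m, rfl⟩ := multisetEquivWord.surjective w
  rw [multisetEquivWord_apply, map_smul, LinearMap.smul_apply, pairL_sigma_wordPi, pairL_stuffle]
  have hinj (x z : Multiset LyndonWord) : toWord x = toWord z ↔ x = z :=
    multisetEquivWord.injective.eq_iff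
  have h1 := comul_multisetPi q m
  rw [multisetPi] at h1
  rw [h1, map_multiset_sum, Multiset.map_map]
  have h2 : ∀ s : Multiset (Multiset LyndonWord × Multiset LyndonWord),
      (s.map (tensorPair (sigma q (toWord a)) (sigma q (toWord b)) ∘
        fun p => multisetPi q p.1 ⊗ₜ[k] multisetPi q p.2)).sum = ((s.count (a, b) : ℕ) : k) := by
    intro s
    induction s using Multiset.induction_on with
    | empty => simp
    | cons p s ih =>
      rw [Multiset.map_cons, Multiset.sum_cons, ih, Multiset.count_cons, Function.comp_apply,
        tensorPair_tmul, multisetPi, multisetPi, pairL_sigma_wordPi, pairL_sigma_wordPi,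
        Nat.cast_add, add_comm, Nat.cast_ite, Nat.cast_one, Nat.cast_zero, ite_zero_mul_ite_zero]
      congr 1
      refine if_congr ?_ (mul_one _) rfl
      rw [Prod.ext_iff, hinj, hinj]
      exact and_congr eq_comm eq_comm
  rw [h2, smul_eq_mul]
  split_ifs with h
  · rw [hinj] at h
    rw [h, mul_one]
  · rw [mul_zero, Multiset.count_eq_zero_of_notMem, Nat.cast_zero]
    rw [Multiset.mem_antidiagonal]
    exact fun h' => h (congrArg toWord h'.symm)

open scoped Classical in
theorem count_antidiagonal_pos (a b : Multiset LyndonWord) :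
    0 < (a + b).antidiagonal.count (a, b) :=
  Multiset.count_pos.2 (Multiset.mem_antidiagonal.2 rfl)

theorem isUnit_natCast {n : ℕ} (hn : n ≠ 0) : IsUnit (n : k) := by
  have : IsUnit (n : ℚ) := isUnit_iff_ne_zero.2 (by exact_mod_cast hn)
  simpa using this.map (algebraMap ℚ k)

theorem pairL_sigma_one (q : k) (m : Multiset LyndonWord) :
    pairL k (sigma q (toWord m)) 1 = if m = 0 then 1 else 0 := by
  rw [← multisetPi_zero q, multisetPi, pairL_sigma_wordPi]
  exact if_congr (multisetEquivWord.injective.eq_iff.trans eq_comm) rfl rfl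

/-- If `a` and `b` are both nonempty, an invertible multiple of the pairing is `⟨Σ_a ⊗ Σ_b | P ⊗ 1 +
1 ⊗ P⟩`, and `Σ_a`, `Σ_b` are orthogonal to `1`. If both are empty, the pairing equals twice itself.
-/
theorem pairL_sigma_primitive (q : k) {P : Poly k} (hP : P ∈ primitives q)
    (a b : Multiset LyndonWord) (hab : a = 0 ↔ b = 0) :
    pairL k (sigma q (toWord (a + b))) P = 0 := by
  classical
  have h1 := pairL_stuffle q (sigma q (toWord a)) (sigma q (toWord b)) P
  have h2 : comul q P = P ⊗ₜ[k] 1 + 1 ⊗ₜ[k] P := hP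
  rw [stuffle_sigma, map_smul, LinearMap.smul_apply, h2, map_add, tensorPair_tmul, tensorPair_tmul,
    pairL_sigma_one, pairL_sigma_one] at h1
  by_cases ha : a = 0
  · have hb := hab.1 ha
    subst ha hb
    simpa using h1
  · rw [if_neg ha, if_neg (fun hb => ha (hab.2 hb)), mul_zero, zero_mul, add_zero] at h1
    exact (isUnit_natCast (count_antidiagonal_pos a b).ne').smul_eq_zero.1 h1

theorem primitives_le_span (q : k) : primitives q ≤
    Submodule.span k (Set.range fun l : LyndonWord => lyndonPi q l.1) := by
  intro P hP
  rw [← (basisPi q).linearCombination_repr P, Finsupp.linearCombination_apply]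
  refine sum_mem fun w hw => ?_
  rw [Finsupp.mem_support_iff, ← Module.Basis.coord_apply, ← pairL_sigma] at hw
  refine Submodule.smul_mem _ _ (Submodule.subset_span ?_)
  obtain ⟨m, rfl⟩ := multisetEquivWord.surjective w
  rw [multisetEquivWord_apply] at hw ⊢
  induction m using Multiset.induction_on with
  | empty =>
    exact absurd (pairL_sigma_primitive q hP 0 0 Iff.rfl) (by simpa using hw)
  | cons l m _ =>
    by_cases hm : m = 0
    · subst hm
      exact ⟨l, by rw [basisPi_apply]; exact (multisetPi_singleton q l).symm⟩
    · refine absurd (pairL_sigma_primitive q hP {l} m ?_) (by simpa using hw)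
      simp [hm]

/-- The family `(Π_l)` as a basis of the primitive polynomials. -/
def basisPrimitives (q : k) : Module.Basis LyndonWord k (primitives q) :=
  Module.Basis.mk
    (v := fun l => ⟨lyndonPi q l.1, lyndonPi_mem_primitives q _ l.1 le_rfl l.2.1⟩)
    (by
      refine LinearIndependent.of_comp (primitives q).subtype ?_
      have h := (basisPi q).linearIndependent.comp (Subtype.val : LyndonWord → Word)
        Subtype.val_injective
      convert h using 1
      funext l
      rw [Function.comp_apply, Function.comp_apply, basisPi_apply, wordPi, l.2.factorization]
      simp)
    (by
      rintro ⟨P, hP⟩ -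
      have h := primitives_le_span q hP
      refine (Submodule.apply_mem_span_image_iff_mem_span (primitives q).injective_subtype).1 ?_
      rw [← Set.range_comp]
      exact h)

theorem coe_basisPrimitives (q : k) (l : LyndonWord) :
    (basisPrimitives q l : Poly k) = lyndonPi q l.1 := by
  simp [basisPrimitives]

/-- `Σ_l` in the `q`-stuffle algebra. -/
def sigmaLyndon (q : k) (l : LyndonWord) : StuffleAlgebra k q := toStuffle q (sigma q l.1)

theorem sigma_toWord_zero (q : k) : sigma q (toWord 0) = 1 := by
  refine ext_pairL_wordPi q fun w => ?_
  obtain ⟨m, rfl⟩ := multisetEquivWord.surjective w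
  rw [pairL_sigma_wordPi, ← word_nil, pairL_word_left, multisetEquivWord_apply]
  split_ifs with h
  · have h1 := multisetPi_zero q
    rw [multisetPi] at h1
    rw [h, h1, ← word_nil, coeff_word, if_pos rfl]
  · refine (coeff_eq_zero (leads_wordPi q _).mem_homogeneous fun h0 => h ?_).symm
    have := length_le_weight (toWord m)
    rw [weight_nil] at h0
    rw [toWord_zero]
    exact List.length_eq_zero_iff.1 (by omega)

/-- Multiplying by one `Σ_l` at a time, `stuffle_sigma` contributes a positive integer at each step,
and these are units of `k`. -/
theorem prod_sigmaLyndon (q : k) (m : Multiset LyndonWord) :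
    ∃ c : kˣ, (m.map (sigmaLyndon q)).prod = c • basisSigma q (toWord m) := by
  classical
  induction m using Multiset.induction_on with
  | empty =>
    refine ⟨1, ?_⟩
    rw [basisSigma_apply, sigma_toWord_zero, one_smul]
    rfl
  | cons l m ih =>
    obtain ⟨c, hc⟩ := ih
    obtain ⟨d, hd⟩ := isUnit_natCast (k := k) (count_antidiagonal_pos {l} m).ne'
    refine ⟨c * d, ?_⟩
    have h : sigmaLyndon q l * basisSigma q (toWord m) = d • basisSigma q (toWord (l ::ₘ m)) := by
      have h1 := stuffle_sigma q {l} m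
      rw [toWord_singleton, Multiset.singleton_add, ← Multiset.singleton_add, ← hd] at h1
      rw [basisSigma_apply, basisSigma_apply]
      exact congrArg (toStuffle q) h1
    rw [Multiset.map_cons, Multiset.prod_cons, hc, mul_smul_comm, h, mul_smul]

/-- The monomials in the `Σ_l` as a basis of the `q`-stuffle algebra. -/
def basisMonomialsSigma (q : k) : Module.Basis (Multiset LyndonWord) k (StuffleAlgebra k q) :=
  ((basisSigma q).reindex multisetEquivWord.symm).unitsSMul fun m => (prod_sigmaLyndon q m).choose

theorem basisMonomialsSigma_apply (q : k) (m : Multiset LyndonWord) :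
    basisMonomialsSigma q m = (m.map (sigmaLyndon q)).prod := by
  rw [(prod_sigmaLyndon q m).choose_spec, basisMonomialsSigma, Module.Basis.unitsSMul_apply,
    Module.Basis.reindex_apply, Equiv.symm_symm, multisetEquivWord_apply]

/-- Evaluation carries the basis of monomials to the basis `basisMonomialsSigma`, exponents being
read as multisets. -/
theorem aeval_sigmaLyndon_bijective (q : k) :
    Function.Bijective (MvPolynomial.aeval (R := k) (sigmaLyndon q)) := by
  classical
  let e := (MvPolynomial.basisMonomials LyndonWord k).equiv (basisMonomialsSigma q)
    Multiset.toFinsupp.symm.toEquiv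
  have h : (MvPolynomial.aeval (R := k) (sigmaLyndon q)).toLinearMap = e.toLinearMap := by
    refine (MvPolynomial.basisMonomials LyndonWord k).ext fun f => ?_
    rw [LinearEquiv.coe_coe, Module.Basis.equiv_apply, basisMonomialsSigma_apply,
      MvPolynomial.coe_basisMonomials, AlgHom.toLinearMap_apply, MvPolynomial.aeval_monomial,
      map_one, one_mul]
    have h1 : Multiset.toFinsupp.symm.toEquiv f = Finsupp.toMultiset f := rfl
    rw [h1, Finsupp.toMultiset_map, Finsupp.prod_toMultiset,
      Finsupp.prod_mapDomain_index (by simp) fun _ _ _ => pow_add _ _ _]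
  have h' : ⇑(MvPolynomial.aeval (R := k) (sigmaLyndon q)) = ⇑e := by
    funext p
    exact LinearMap.congr_fun h p
  rw [h']
  exact e.bijective

theorem isTranscendenceBasis_sigmaLyndon (q : k) : IsTranscendenceBasis k (sigmaLyndon q) := by
  have : Nonempty LyndonWord := ⟨⟨[y 1], isLyndon_singleton _⟩⟩
  have h := (AlgEquiv.ofBijective _ (aeval_sigmaLyndon_bijective q)).isTranscendenceBasis
    (IsTranscendenceBasis.mvPolynomial' LyndonWord k)
  convert h using 1
  funext l
  simp

theorem adjoin_sigmaLyndon (q : k) : Algebra.adjoin k (Set.range (sigmaLyndon q)) = ⊤ := by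
  rw [Algebra.adjoin_range_eq_range_aeval]
  exact AlgHom.range_eq_top _ |>.2 (aeval_sigmaLyndon_bijective q).2

end Multisets
end QStuffle

theorem mainTheorem1 {k : Type*} [CommRing k] [Algebra ℚ k] (q : k) :
    (∃ b : Module.Basis {l : QStuffle.Word // QStuffle.IsLyndon l} k (QStuffle.primitives q),
      ∀ l, (b l : QStuffle.Poly k) = QStuffle.lyndonPi q l.1) ∧
    (∃ b : Module.Basis QStuffle.Word k (QStuffle.Poly k),
      ∀ w, b w = QStuffle.wordPi q w) ∧
    ∃ S : QStuffle.Word → QStuffle.Poly k,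
      QStuffle.IsDualFamily q S ∧
      (∀ S' : QStuffle.Word → QStuffle.Poly k, QStuffle.IsDualFamily q S' → S' = S) ∧
      (∃ b : Module.Basis QStuffle.Word k (QStuffle.StuffleAlgebra k q),
        ∀ w, b w = QStuffle.toStuffle q (S w)) ∧
      IsTranscendenceBasis k
        (fun l : {l : QStuffle.Word // QStuffle.IsLyndon l} => QStuffle.toStuffle q (S l.1)) ∧
      Algebra.adjoin k (Set.range
        (fun l : {l : QStuffle.Word // QStuffle.IsLyndon l} => QStuffle.toStuffle q (S l.1))) = ⊤ := by
  refine ⟨⟨QStuffle.basisPrimitives q, QStuffle.coe_basisPrimitives q⟩,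
    ⟨QStuffle.basisPi q, QStuffle.basisPi_apply q⟩,
    QStuffle.sigma q, QStuffle.isDualFamily_sigma q, fun _ h => h.eq_sigma,
    ⟨QStuffle.basisSigma q, QStuffle.basisSigma_apply q⟩,
    QStuffle.isTranscendenceBasis_sigmaLyndon q, QStuffle.adjoin_sigmaLyndon q⟩
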